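/- Let $\mathbb{H}P^n$ be the space of lines $\mathbb{H}h$ of the left $\mathbb{H}$-module $\mathbb{H}^{n+1}$, let $S^{4n+3}\to\mathbb{H}P^n$ be the Hopf bundle (a principal $S^3$-bundle, $S^3=Sp(1)$ acting by left multiplication), and let $B$ be a compact real submanifold of $\mathbb{H}P^n$ (more generally, a compact Hausdorff smooth manifold with a smooth immersion $\iota:B\to\mathbb{H}P^n$). Let $\pi:P\to B$ be the induced principal $S^3$-bundle, $P=\{(b,h)\in B\times S^{4n+3} : \iota(b)=\mathbb{H}h\}$. Suppose that $B$ carries a Sasakian structure $(\varphi,\xi,\eta,g^B)$, i.e. a normal contact metric structure; it need not be induced from $\mathbb{H}P^n$. Thus $g^B$ is a Riemannian metric, $\eta(\xi)=1$, $\varphi^2=-1+\eta\otimes\xi$, $g^B(\varphi X,\varphi Y)=g^B(X,Y)-\eta(X)\eta(Y)$, $d\eta(X,Y)=g^B(X,\varphi Y)$ and $[\varphi,\varphi]+2\,d\eta\otimes\xi=0$, where $[\varphi,\varphi]$ is the Nijenhuis torsion and $2\,d\eta(X,Y)=X\eta(Y)-Y\eta(X)-\eta([X,Y])$. Let $\mathcal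 H$ be the $sp(1)$-connection on $P$ induced from the canonical connection of the Hopf bundle, whose horizontal spaces are the orthogonal complements of the fibres in $S^{4n+3}$; let $\omega$ be its $\mathrm{Im}\,\mathbb{H}$-valued connection form and $\Omega=d\omega(\mathrm{hor}\,\cdot,\mathrm{hor}\,\cdot)$ its curvature form. For a vector field $X$ on $B$ let $X^*$ be its $\mathcal H$-horizontal lift to $P$. Let $\xi_1,\xi_2,\xi_3$ be the vertical vector fields on $P$ generated by the $S^3$-action, given at $(b,h)$ by $-ih$, $-jh$, $-kh$. Let $J$ be the field of endomorphisms of $TP$ determined by $$J\xi_1=\xi_2,\quad J\xi_2=-\xi_1,\quad J\xi_3=\xi^*,\quad J\xi^*=-\xi_3,\quad JX^*=(\varphi X)^*\ \text{ for } X\perp\xi .$$ If $$\Omega\big((\varphi X)^*,(\varphi Y)^*\big)=\Omega(X^*,Y^*)\quad\text{and}\quad \Omega(X^*,\xi^*)=0$$ for all vector fields $X,Y\perp\xi$ on $B$, then $J$ is an integrable almost complex structure on $P$: it is smooth, $J^2=-1$, and its Nijenhuis tensor vanishes. -/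

import Mathlib

open scoped Manifold ContDiff Quaternion
open Bundle VectorField Metric

noncomputable section

namespace HopfSasaki

/-! ### Quaternionic projective space -/

/-- `ℍⁿ⁺¹` with its Euclidean norm, regarded as a left `ℍ`-module. -/
abbrev HVec (n : ℕ) : Type := PiLp 2 (fun _ : Fin (n + 1) => ℍ)

/-- Quaternionic projective space `ℍPⁿ`: the lines through the origin of the left `ℍ`-module
`ℍⁿ⁺¹`. -/
def HP (n : ℕ) : Type := Projectivization ℍ (HVec n)

namespace HP

variable {n : ℕ}

/-- The line spanned by a nonzero vector. -/
def line (v : {v : HVec n // v ≠ 0}) : HP n := Projectivization.mk ℍ v.1 v.2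

/-- A nonzero vector on a line. -/
def rep (L : HP n) : HVec n := Projectivization.rep L

/-- The quotient topology. -/
instance : TopologicalSpace (HP n) := TopologicalSpace.coinduced line inferInstance

/-- The inverse of the `i`-th affine chart, as a vector:
`w ↦ (w₀, …, wᵢ₋₁, 1, wᵢ, …, wₙ₋₁)`. -/
def affineVec (i : Fin (n + 1)) (w : Fin n → ℍ) : HVec n :=
  WithLp.toLp 2 (i.insertNth (1 : ℍ) w)

theorem affineVec_self (i : Fin (n + 1)) (w : Fin n → ℍ) : affineVec i w i = 1 := by
  simp [affineVec]

theorem affineVec_succAbove (i : Fin (n + 1)) (w : Fin n → ℍ) (j : Fin n) :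
    affineVec i w (i.succAbove j) = w j := by
  simp [affineVec]

theorem affineVec_ne_zero (i : Fin (n + 1)) (w : Fin n → ℍ) : affineVec i w ≠ 0 := by
  intro h
  have := affineVec_self i w
  rw [h] at this
  simp at this

theorem rep_line (v : {v : HVec n // v ≠ 0}) : ∃ a : ℍ, a ≠ 0 ∧ rep (line v) = a • v.1 := by
  obtain ⟨a, ha⟩ := Projectivization.exists_smul_eq_mk_rep ℍ v.1 v.2
  exact ⟨a, a.ne_zero, ha.symm⟩

theorem line_rep (L : HP n) : line ⟨rep L, Projectivization.rep_nonzero L⟩ = L :=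
  Projectivization.mk_rep L

theorem line_eq_of_smul {v w : {v : HVec n // v ≠ 0}} (a : ℍ) (h : v.1 = a • w.1) :
    line v = line w :=
  (Projectivization.mk_eq_mk_iff' ℍ v.1 w.1 v.2 w.2).2 ⟨a, h.symm⟩

theorem line_surjective : Function.Surjective (line (n := n)) := fun L => ⟨_, line_rep L⟩

theorem isQuotientMap_line : Topology.IsQuotientMap (line (n := n)) :=
  ⟨⟨rfl⟩, line_surjective⟩

/-- The affine coordinates `hᵢ⁻¹ hⱼ`, `j ≠ i`, of the line spanned by `h`. -/
def affineCoord (i : Fin (n + 1)) (L : HP n) : Fin n → ℍ :=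
  fun j => (rep L i)⁻¹ * rep L (i.succAbove j)

theorem affineCoord_line (i : Fin (n + 1)) (v : {v : HVec n // v ≠ 0}) (j : Fin n) :
    affineCoord i (line v) j = (v.1 i)⁻¹ * v.1 (i.succAbove j) := by
  obtain ⟨a, ha, h⟩ := rep_line v
  simp [affineCoord, h, mul_inv_rev, mul_assoc, ha]

theorem rep_line_ne_zero_iff (i : Fin (n + 1)) (v : {v : HVec n // v ≠ 0}) :
    rep (line v) i ≠ 0 ↔ v.1 i ≠ 0 := by
  obtain ⟨a, ha, h⟩ := rep_line v
  simp [h, ha]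

theorem line_affineVec_affineCoord (i : Fin (n + 1)) (v : {v : HVec n // v ≠ 0})
    (hv : v.1 i ≠ 0) :
    affineVec i (affineCoord i (line v)) = (v.1 i)⁻¹ • v.1 := by
  ext1 k
  rcases Fin.eq_self_or_eq_succAbove i k with rfl | ⟨j, rfl⟩
  · simp [affineVec_self, hv]
  · simp [affineVec_succAbove, affineCoord_line]

theorem continuous_affineVec (i : Fin (n + 1)) : Continuous (affineVec (n := n) i) := by
  refine (PiLp.continuous_toLp 2 _).comp (continuous_pi fun k => ?_)
  rcases Fin.eq_self_or_eq_succAbove i k with rfl | ⟨j, rfl⟩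
  · simpa using continuous_const
  · simpa using continuous_apply j

theorem isOpen_source (i : Fin (n + 1)) : IsOpen {L : HP n | rep L i ≠ 0} := by
  rw [← isQuotientMap_line.isOpen_preimage]
  have : line ⁻¹' {L : HP n | rep L i ≠ 0} = {v : {v : HVec n // v ≠ 0} | v.1 i ≠ 0} := by
    ext v
    exact rep_line_ne_zero_iff i v
  rw [this]
  refine isOpen_ne_fun ?_ continuous_const
  fun_prop

/-- The `i`-th affine chart `[h] ↦ (hᵢ⁻¹ hⱼ)_{j ≠ i}`, defined on `{[h] | hᵢ ≠ 0}`. -/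
def affineChart (i : Fin (n + 1)) : OpenPartialHomeomorph (HP n) (Fin n → ℍ) where
  toFun := affineCoord i
  invFun w := line ⟨affineVec i w, affineVec_ne_zero i w⟩
  source := {L | rep L i ≠ 0}
  target := Set.univ
  map_source' _ _ := Set.mem_univ _
  map_target' w _ := by
    change rep _ i ≠ 0
    rw [rep_line_ne_zero_iff]
    simp [affineVec_self]
  left_inv' L hL := by
    obtain ⟨v, rfl⟩ := line_surjective L
    have hv : v.1 i ≠ 0 := (rep_line_ne_zero_iff i v).1 hL
    exact line_eq_of_smul (v.1 i)⁻¹ (line_affineVec_affineCoord i v hv)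
  right_inv' w _ := by
    funext j
    rw [affineCoord_line]
    simp [affineVec_self, affineVec_succAbove]
  open_source := isOpen_source i
  open_target := isOpen_univ
  continuousOn_toFun := by
    refine (isQuotientMap_line.continuousOn_isOpen_iff (isOpen_source i)).2 ?_
    refine continuousOn_pi.2 fun j => ?_
    have : ContinuousOn (fun v : {v : HVec n // v ≠ 0} => (v.1 i)⁻¹ * v.1 (i.succAbove j))
        (line ⁻¹' {L : HP n | rep L i ≠ 0}) := by
      refine ContinuousOn.mul (ContinuousOn.inv₀ (by fun_prop) fun v hv => ?_) (by fun_prop)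
      exact (rep_line_ne_zero_iff i v).1 hv
    exact this.congr fun v _ => affineCoord_line i v j
  continuousOn_invFun := by
    refine Continuous.continuousOn ?_
    exact isQuotientMap_line.continuous.comp ((continuous_affineVec i).subtype_mk _)

theorem exists_rep_ne_zero (L : HP n) : ∃ i, rep L i ≠ 0 := by
  by_contra! h
  exact Projectivization.rep_nonzero L (PiLp.ext h)

instance : ChartedSpace (Fin n → ℍ) (HP n) where
  atlas := Set.range affineChart
  chartAt L := affineChart (exists_rep_ne_zero L).choose
  mem_chart_source L := (exists_rep_ne_zero L).choose_spec
  chart_mem_atlas _ := ⟨_, rfl⟩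

theorem contDiffAt_inv {x : ℍ} (hx : x ≠ 0) : ContDiffAt ℝ ∞ (fun q : ℍ => q⁻¹) x := by
  have := contDiffAt_ringInverse ℝ (n := ∞) (Units.mk0 x hx)
  rwa [Ring.inverse_eq_inv'] at this

theorem contDiff_affineVec (i : Fin (n + 1)) : ContDiff ℝ ∞ (affineVec (n := n) i) := by
  rw [contDiff_piLp 2]
  intro k
  rcases Fin.eq_self_or_eq_succAbove i k with rfl | ⟨j, rfl⟩
  · simpa only [affineVec_self] using contDiff_const
  · simpa only [affineVec_succAbove] using contDiff_apply ℝ ℍ j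

instance : IsManifold 𝓘(ℝ, Fin n → ℍ) ∞ (HP n) := by
  refine isManifold_of_contDiffOn _ _ _ ?_
  rintro _ _ ⟨i, rfl⟩ ⟨k, rfl⟩
  have key : ContDiffOn ℝ ∞
      (fun (w : Fin n → ℍ) (j : Fin n) => (affineVec i w k)⁻¹ * affineVec i w (k.succAbove j))
      {w | affineVec i w k ≠ 0} := by
    have hc : ∀ l, ContDiff ℝ ∞ (fun w : Fin n → ℍ => affineVec i w l) :=
      (contDiff_piLp 2).1 (contDiff_affineVec i)
    refine contDiffOn_pi.2 fun j => ContDiffOn.mul ?_ (hc _).contDiffOn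
    intro w hw
    exact ((contDiffAt_inv hw).comp w (hc k).contDiffAt).contDiffWithinAt
  refine (key.congr ?_).mono ?_
  · intro w _
    funext j
    exact affineCoord_line k _ j
  · intro w hw
    have h := hw.1.2
    exact (rep_line_ne_zero_iff k _).1 h

end HP

/-! ### The induced Hopf bundle -/

/-- The group `S³ = Sp(1)` of unit quaternions. -/
abbrev S3 : Type := sphere (0 : ℍ) 1

instance : Fact (Module.finrank ℝ ℍ = 3 + 1) := ⟨Quaternion.finrank_eq_four⟩

/-- The Hopf fibration `S⁴ⁿ⁺³ → ℍPⁿ`. -/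
def hopf {n : ℕ} (h : sphere (0 : HVec n) 1) : HP n :=
  HP.line ⟨h, ne_zero_of_mem_unit_sphere h⟩

open Classical in
/-- The direction `q / ‖q‖` of a nonzero quaternion (and `1` for `q = 0`). -/
def dir (q : ℍ) : S3 :=
  if h : q = 0 then 1 else ⟨‖q‖⁻¹ • q, by simp [norm_smul, h]⟩

theorem coe_dir {q : ℍ} (h : q ≠ 0) : (dir q : ℍ) = ‖q‖⁻¹ • q := by
  simp [dir, h]

theorem dir_smul (u : S3) {q : ℍ} (h : q ≠ 0) : dir (u * q) = u * dir q := by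
  have hu : (u : ℍ) ≠ 0 := ne_zero_of_mem_unit_sphere u
  ext1
  rw [coe_dir (mul_ne_zero hu h), Metric.unitSphere.coe_mul, coe_dir h]
  simp

/-- Scalar multiplication of unit vectors by unit quaternions. -/
def sphereSMul {n : ℕ} (u : S3) (h : sphere (0 : HVec n) 1) : sphere (0 : HVec n) 1 :=
  ⟨(u : ℍ) • (h : HVec n), by simp [norm_smul]⟩

theorem hopf_sphereSMul {n : ℕ} (u : S3) (h : sphere (0 : HVec n) 1) :
    hopf (sphereSMul u h) = hopf h :=
  HP.line_eq_of_smul (u : ℍ) rfl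

/-- The `i`-th local section of the Hopf fibration: the unit vector on the line `L` whose
`i`-th entry is a positive real number (a junk unit vector on `L` if the `i`-th entries of the
vectors of `L` vanish). -/
def hopfSec {n : ℕ} (i : Fin (n + 1)) (L : HP n) : sphere (0 : HVec n) 1 :=
  ⟨‖HP.rep L‖⁻¹ • (((dir (HP.rep L i))⁻¹ : S3) : ℍ) • HP.rep L, by
    have : ‖HP.rep L‖ ≠ 0 := norm_ne_zero_iff.2 (Projectivization.rep_nonzero L)
    simp [norm_smul, this]⟩


theorem coe_hopfSec {n : ℕ} {i : Fin (n + 1)} {L : HP n} (hL : HP.rep L i ≠ 0) :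
    (hopfSec i L : HVec n) =
      ‖HP.affineVec i (HP.affineCoord i L)‖⁻¹ • HP.affineVec i (HP.affineCoord i L) := by
  have h := HP.line_affineVec_affineCoord i ⟨HP.rep L, Projectivization.rep_nonzero L⟩ hL
  rw [HP.line_rep] at h
  have hd : (((dir (HP.rep L i))⁻¹ : S3) : ℍ) = ‖HP.rep L i‖ • (HP.rep L i)⁻¹ := by
    rw [Metric.unitSphere.coe_inv, coe_dir hL, smul_inv₀, inv_inv]
  have hn : ‖HP.rep L i‖ ≠ 0 := norm_ne_zero_iff.2 hL
  simp only [hopfSec, h, hd, norm_smul, norm_inv, mul_inv, inv_inv, smul_smul, smul_assoc]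
  rw [mul_comm]

theorem hopf_hopfSec {n : ℕ} (i : Fin (n + 1)) (L : HP n) : hopf (hopfSec i L) = L := by
  conv_rhs => rw [← HP.line_rep L]
  refine HP.line_eq_of_smul (‖HP.rep L‖⁻¹ • (((dir (HP.rep L i))⁻¹ : S3) : ℍ)) ?_
  exact (smul_assoc _ _ _).symm

theorem rep_hopf_ne_zero_iff {n : ℕ} (i : Fin (n + 1)) (h : sphere (0 : HVec n) 1) :
    HP.rep (hopf h) i ≠ 0 ↔ (h : HVec n) i ≠ 0 :=
  HP.rep_line_ne_zero_iff i _

theorem sphereSMul_hopfSec {n : ℕ} {i : Fin (n + 1)} (h : sphere (0 : HVec n) 1)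
    (hi : (h : HVec n) i ≠ 0) :
    sphereSMul (dir ((h : HVec n) i)) (hopfSec i (hopf h)) = h := by
  ext1
  have hn : ‖(h : HVec n) i‖ ≠ 0 := norm_ne_zero_iff.2 hi
  have h1 : ‖(h : HVec n)‖ = 1 := norm_eq_of_mem_sphere h
  change (dir ((h : HVec n) i) : ℍ) • (hopfSec i (hopf h) : HVec n) = h
  rw [coe_hopfSec ((rep_hopf_ne_zero_iff i h).2 hi), coe_dir hi]
  rw [hopf, HP.line_affineVec_affineCoord i _ hi]
  simp only [norm_smul, norm_inv, h1, mul_one, inv_inv]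
  rw [smul_comm, smul_assoc, smul_smul, mul_inv_cancel₀ hn, smul_smul, mul_inv_cancel₀ hi, one_smul, one_smul]

theorem hopfSec_apply_self {n : ℕ} {i : Fin (n + 1)} {L : HP n} (hL : HP.rep L i ≠ 0) :
    ∃ r : ℝ, 0 < r ∧ (hopfSec i L : HVec n) i = (r : ℍ) := by
  refine ⟨‖HP.affineVec i (HP.affineCoord i L)‖⁻¹, ?_, ?_⟩
  · exact inv_pos.2 (norm_pos_iff.2 (HP.affineVec_ne_zero _ _))
  · rw [coe_hopfSec hL, PiLp.smul_apply, HP.affineVec_self]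
    rw [← Quaternion.coe_one, ← Quaternion.coe_smul, smul_eq_mul, mul_one]

theorem dir_coe {r : ℝ} (hr : 0 < r) : dir (r : ℍ) = 1 := by
  ext1
  rw [coe_dir (norm_ne_zero_iff.1 (by rw [Quaternion.norm_coe]; simpa using hr.ne')), Quaternion.norm_coe, Real.norm_of_nonneg hr.le]
  rw [← Quaternion.coe_smul, smul_eq_mul, inv_mul_cancel₀ hr.ne']
  simp

variable {n m : ℕ} {B : Type*} [TopologicalSpace B] [ChartedSpace (EuclideanSpace ℝ (Fin m)) B]

/-- The total space of the principal `S³`-bundle over `B` induced from the Hopf bundle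
`S⁴ⁿ⁺³ → ℍPⁿ` by a smooth map `ι : B → ℍPⁿ`: the fibre product of `B` and `S⁴ⁿ⁺³` over `ℍPⁿ`,
with the subspace topology. -/
def InducedBundle (ι : C^∞⟮𝓡 m, B; 𝓘(ℝ, Fin n → ℍ), HP n⟯) : Type _ :=
  {x : B × sphere (0 : HVec n) 1 // hopf x.2 = ι x.1}

namespace InducedBundle

variable (ι : C^∞⟮𝓡 m, B; 𝓘(ℝ, Fin n → ℍ), HP n⟯)

instance : TopologicalSpace (InducedBundle ι) := instTopologicalSpaceSubtype

/-- The bundle projection. -/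
def proj (p : InducedBundle ι) : B := p.1.1

/-- The map to the total space `S⁴ⁿ⁺³ ⊂ ℍⁿ⁺¹` of the Hopf bundle. -/
def toVec (p : InducedBundle ι) : HVec n := p.1.2

/-- The principal action of `S³`. -/
def act (u : S3) (p : InducedBundle ι) : InducedBundle ι :=
  ⟨(p.1.1, sphereSMul u p.1.2), (hopf_sphereSMul u p.1.2).trans p.2⟩

/-- The `i`-th local trivialization `(b, h) ↦ (b, hᵢ / ‖hᵢ‖)` of the induced bundle. -/
def triv (i : Fin (n + 1)) : OpenPartialHomeomorph (InducedBundle ι) (B × S3) where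
  toFun p := (p.1.1, dir ((p.1.2 : HVec n) i))
  invFun x := ⟨(x.1, sphereSMul x.2 (hopfSec i (ι x.1))),
    (hopf_sphereSMul _ _).trans (hopf_hopfSec _ _)⟩
  source := {p | (p.1.2 : HVec n) i ≠ 0}
  target := {x | HP.rep (ι x.1) i ≠ 0}
  map_source' p hp := by
    change HP.rep (ι p.1.1) i ≠ 0
    rw [← p.2]
    exact (rep_hopf_ne_zero_iff i _).2 hp
  map_target' x hx := by
    change (sphereSMul x.2 (hopfSec i (ι x.1)) : HVec n) i ≠ 0
    rw [← rep_hopf_ne_zero_iff, hopf_sphereSMul, hopf_hopfSec]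
    exact hx
  left_inv' p hp := by
    refine Subtype.ext (Prod.ext rfl ?_)
    change sphereSMul (dir ((p.1.2 : HVec n) i)) (hopfSec i (ι p.1.1)) = p.1.2
    rw [← p.2]
    exact sphereSMul_hopfSec _ hp
  right_inv' x hx := by
    refine Prod.ext rfl ?_
    obtain ⟨r, hr, h⟩ := hopfSec_apply_self hx
    have hr' : (r : ℍ) ≠ 0 := norm_ne_zero_iff.1 (by rw [Quaternion.norm_coe]; simpa using hr.ne')
    change dir ((x.2 : ℍ) * (hopfSec i (ι x.1) : HVec n) i) = x.2
    rw [h, dir_smul _ hr', dir_coe hr, mul_one]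
  open_source := by
    refine isOpen_ne_fun ?_ continuous_const
    have : Continuous fun p : InducedBundle ι => p.1 := continuous_subtype_val
    fun_prop
  open_target :=
    (HP.isOpen_source i).preimage (ι.contMDiff.continuous.comp continuous_fst)
  continuousOn_toFun := by
    have hv : Continuous fun p : InducedBundle ι => p.1 := continuous_subtype_val
    refine (Continuous.continuousOn (by fun_prop)).prodMk ?_
    refine continuousOn_iff_continuous_domRestrict.2 ?_
    refine continuous_induced_rng.2 ?_
    have : Continuous fun p : {p : InducedBundle ι | (p.1.2 : HVec n) i ≠ 0} =>
        ‖(p.1.1.2 : HVec n) i‖⁻¹ • (p.1.1.2 : HVec n) i := by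
      have h1 : Continuous fun p : {p : InducedBundle ι | (p.1.2 : HVec n) i ≠ 0} =>
        (p.1.1.2 : HVec n) i := by fun_prop
      exact (h1.norm.inv₀ fun p => norm_ne_zero_iff.2 p.2).smul h1
    exact this.congr fun p => (coe_dir p.2).symm
  continuousOn_invFun := by
    refine continuousOn_iff_continuous_domRestrict.2 ?_
    refine Continuous.subtype_mk
      ((continuous_fst.comp continuous_subtype_val).prodMk ?_) _
    refine continuous_induced_rng.2 ?_
    have h1 : ContinuousOn (fun x : B × S3 => HP.affineCoord i (ι x.1))
        {x | HP.rep (ι x.1) i ≠ 0} :=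
      (HP.affineChart i).continuousOn.comp
        (ι.contMDiff.continuous.comp continuous_fst).continuousOn fun x hx => hx
    have h2 := (HP.continuous_affineVec i).comp_continuousOn h1
    have h3 : ContinuousOn (fun x : B × S3 => (x.2 : ℍ) •
        (‖HP.affineVec i (HP.affineCoord i (ι x.1))‖⁻¹ •
          HP.affineVec i (HP.affineCoord i (ι x.1))))
        {x | HP.rep (ι x.1) i ≠ 0} := by
      refine ContinuousOn.smul
        (continuous_subtype_val.comp continuous_snd).continuousOn ?_
      exact (h2.norm.inv₀ fun x _ => norm_ne_zero_iff.2 (HP.affineVec_ne_zero _ _)).smul h2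
    refine (continuousOn_iff_continuous_domRestrict.1 h3).congr fun x => ?_
    change _ = (x.1.2 : ℍ) • (hopfSec i (ι x.1.1) : HVec n)
    rw [coe_hopfSec x.2]
    rfl

theorem exists_apply_ne_zero (p : InducedBundle ι) : ∃ i, (p.1.2 : HVec n) i ≠ 0 := by
  by_contra! h
  exact ne_zero_of_mem_unit_sphere p.1.2 (PiLp.ext h)

/-- The charts of the induced bundle: the local trivializations, followed by the charts of
`B × S³`. -/
instance : ChartedSpace (ModelProd (EuclideanSpace ℝ (Fin m)) (EuclideanSpace ℝ (Fin 3)))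
    (InducedBundle ι) where
  atlas := {e | ∃ (i : Fin (n + 1)),
    ∃ χ ∈ atlas (ModelProd (EuclideanSpace ℝ (Fin m)) (EuclideanSpace ℝ (Fin 3))) (B × S3),
      e = triv ι i ≫ₕ χ}
  chartAt p := triv ι (exists_apply_ne_zero ι p).choose ≫ₕ
    chartAt _ (triv ι (exists_apply_ne_zero ι p).choose p)
  mem_chart_source p := by
    rw [OpenPartialHomeomorph.trans_source]
    refine ⟨(exists_apply_ne_zero ι p).choose_spec, ?_⟩
    rw [Set.mem_preimage]
    exact mem_chart_source _ _
  chart_mem_atlas _ := ⟨_, _, chart_mem_atlas _ _, rfl⟩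

end InducedBundle

theorem contMDiffOn_sphere_iff {E₁ : Type*} [NormedAddCommGroup E₁] [NormedSpace ℝ E₁] {H₁ : Type*}
    [TopologicalSpace H₁] {I₁ : ModelWithCorners ℝ E₁ H₁} {M : Type*} [TopologicalSpace M]
    [ChartedSpace H₁ M] [IsManifold I₁ ∞ M] {f : M → S3} {s : Set M}
    (hf : ContMDiffOn I₁ 𝓘(ℝ, ℍ) ∞ (fun x => (f x : ℍ)) s) : ContMDiffOn I₁ (𝓡 3) ∞ f s := by
  rw [contMDiffOn_iff_target]
  refine ⟨Topology.IsInducing.subtypeVal.continuousOn_iff.2 hf.continuousOn, ?_⟩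
  intro v
  let U : _ ≃ₗᵢ[ℝ] _ :=
    (OrthonormalBasis.fromOrthogonalSpanSingleton (𝕜 := ℝ) 3
      (ne_zero_of_mem_unit_sphere (-v))).repr
  have h : ContDiffOn ℝ ω _ Set.univ := U.contDiff.contDiffOn
  have H₁ := (h.comp_inter contDiffOn_stereoToFun).contMDiffOn
  convert! (H₁.of_le le_top).comp' hf using 1
  ext x
  have hfxv : (f x : ℍ) = -↑v ↔ inner ℝ (f x : ℍ) (-↑v) = 1 := by
    have hfx : ‖(f x : ℍ)‖ = 1 := norm_eq_of_mem_sphere _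
    rw [inner_eq_one_iff_of_norm_eq_one hfx]
    exact norm_eq_of_mem_sphere (-v)
  simp [chartAt, ChartedSpace.chartAt, Subtype.ext_iff, hfxv, real_inner_comm]

namespace InducedBundle

variable [IsManifold (𝓡 m) ∞ B] (ι : C^∞⟮𝓡 m, B; 𝓘(ℝ, Fin n → ℍ), HP n⟯)

theorem contMDiffOn_triv (i k : Fin (n + 1)) :
    ContMDiffOn ((𝓡 m).prod (𝓡 3)) ((𝓡 m).prod (𝓡 3)) ∞
      ((triv ι i).symm ≫ₕ triv ι k) ((triv ι i).symm ≫ₕ triv ι k).source := by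
  refine ContMDiffOn.prodMk contMDiff_fst.contMDiffOn (contMDiffOn_sphere_iff ?_)
  have hs : ∀ x ∈ ((triv ι i).symm ≫ₕ triv ι k).source,
      HP.rep (ι x.1) i ≠ 0 ∧ (x.2 : ℍ) * (hopfSec i (ι x.1) : HVec n) k ≠ 0 :=
    fun x hx => ⟨hx.1, hx.2⟩
  have hw : ContMDiffOn ((𝓡 m).prod (𝓡 3)) 𝓘(ℝ, Fin n → ℍ) ∞
      (fun x : B × S3 => HP.affineCoord i (ι x.1)) ((triv ι i).symm ≫ₕ triv ι k).source :=
    (contMDiffOn_of_mem_maximalAtlas (IsManifold.subset_maximalAtlas (n := ∞)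
      (I := 𝓘(ℝ, Fin n → ℍ)) (Set.mem_range_self i) :
        HP.affineChart i ∈ IsManifold.maximalAtlas 𝓘(ℝ, Fin n → ℍ) ∞ (HP n))).comp
      (ι.contMDiff.comp contMDiff_fst).contMDiffOn fun x hx => (hs x hx).1
  have hu : ContMDiff ((𝓡 m).prod (𝓡 3)) 𝓘(ℝ, ℍ) ∞ (fun x : B × S3 => (x.2 : ℍ)) :=
    contMDiff_coe_sphere.comp contMDiff_snd
  have hF : ContDiffOn ℝ ∞ (fun y : (Fin n → ℍ) × ℍ =>
      ‖y.2 * HP.affineVec i y.1 k‖⁻¹ • (y.2 * HP.affineVec i y.1 k))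
      {y | y.2 * HP.affineVec i y.1 k ≠ 0} := by
    have h1 : ContDiffOn ℝ ∞ (fun y : (Fin n → ℍ) × ℍ => y.2 * HP.affineVec i y.1 k)
        {y | y.2 * HP.affineVec i y.1 k ≠ 0} :=
      (contDiff_snd.mul (((contDiff_piLp 2).1 (HP.contDiff_affineVec i) k).comp
        contDiff_fst)).contDiffOn
    exact ((h1.norm ℝ fun y hy => hy).inv fun y hy => norm_ne_zero_iff.2 hy).smul h1
  have hsec : ∀ x ∈ ((triv ι i).symm ≫ₕ triv ι k).source,
      (x.2 : ℍ) * (hopfSec i (ι x.1) : HVec n) k =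
      ‖HP.affineVec i (HP.affineCoord i (ι x.1))‖⁻¹ •
        ((x.2 : ℍ) * HP.affineVec i (HP.affineCoord i (ι x.1)) k) := by
    intro x hx
    rw [coe_hopfSec (hs x hx).1, PiLp.smul_apply, mul_smul_comm]
  have hne : ∀ x ∈ ((triv ι i).symm ≫ₕ triv ι k).source,
      (x.2 : ℍ) * HP.affineVec i (HP.affineCoord i (ι x.1)) k ≠ 0 := by
    intro x hx h0
    refine (hs x hx).2 ?_
    rw [hsec x hx, h0, smul_zero]
  refine (hF.contMDiffOn.comp (hw.prodMk_space hu.contMDiffOn) hne).congr fun x hx => ?_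
  change (dir ((x.2 : ℍ) * (hopfSec i (ι x.1) : HVec n) k) : ℍ) = _
  rw [coe_dir (hs x hx).2, hsec x hx]
  have hr : (0 : ℝ) < ‖HP.affineVec i (HP.affineCoord i (ι x.1))‖⁻¹ :=
    inv_pos.2 (norm_pos_iff.2 (HP.affineVec_ne_zero _ _))
  generalize ‖HP.affineVec i (HP.affineCoord i (ι x.1))‖⁻¹ = r at hr
  simp only [Function.comp, norm_smul, Real.norm_of_nonneg hr.le, mul_inv, smul_smul]
  congr 1
  field_simp

/-- The induced bundle is a smooth manifold. -/
instance : IsManifold ((𝓡 m).prod (𝓡 3)) ∞ (InducedBundle ι) := by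
  refine isManifold_of_contDiffOn _ _ _ ?_
  rintro _ _ ⟨i, χ, hχ, rfl⟩ ⟨k, χ', hχ', rfl⟩
  have h1 : ContMDiffOn ((𝓡 m).prod (𝓡 3)) ((𝓡 m).prod (𝓡 3)) ∞ χ.symm χ.target :=
    contMDiffOn_symm_of_mem_maximalAtlas (IsManifold.subset_maximalAtlas hχ)
  have h2 : ContMDiffOn ((𝓡 m).prod (𝓡 3)) ((𝓡 m).prod (𝓡 3)) ∞ χ' χ'.source :=
    contMDiffOn_of_mem_maximalAtlas (IsManifold.subset_maximalAtlas hχ')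
  have h3 : ContMDiffOn ((𝓡 m).prod (𝓡 3)) ((𝓡 m).prod (𝓡 3)) ∞
      ((triv ι i ≫ₕ χ).symm ≫ₕ (triv ι k ≫ₕ χ'))
      ((triv ι i ≫ₕ χ).symm ≫ₕ (triv ι k ≫ₕ χ')).source := by
    refine (h2.comp ((contMDiffOn_triv ι i k).comp (h1.mono ?_) ?_) ?_)
    · intro y hy
      exact hy.1.1
    · intro y hy
      exact ⟨hy.1.2, hy.2.1⟩
    · intro y hy
      exact hy.2.2
  let f : EuclideanSpace ℝ (Fin m) × EuclideanSpace ℝ (Fin 3) →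
      EuclideanSpace ℝ (Fin m) × EuclideanSpace ℝ (Fin 3) :=
    (triv ι i ≫ₕ χ).symm ≫ₕ (triv ι k ≫ₕ χ')
  let s : Set (EuclideanSpace ℝ (Fin m) × EuclideanSpace ℝ (Fin 3)) :=
    ((triv ι i ≫ₕ χ).symm ≫ₕ (triv ι k ≫ₕ χ')).source
  have h4 : ContMDiffOn 𝓘(ℝ, EuclideanSpace ℝ (Fin m) × EuclideanSpace ℝ (Fin 3))
      𝓘(ℝ, EuclideanSpace ℝ (Fin m) × EuclideanSpace ℝ (Fin 3)) ∞ f s := by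
    rw [modelWithCornersSelf_prod]
    exact h3
  refine (contMDiffOn_iff_contDiffOn.1 h4).mono ?_
  rintro y ⟨hy, -⟩
  exact hy

end InducedBundle

/-! ### Vector fields, forms and tensors -/

section Tensors

variable {E : Type*} [NormedAddCommGroup E] [NormedSpace ℝ E] {H : Type*} [TopologicalSpace H]
  (I : ModelWithCorners ℝ E H) {M : Type*} [TopologicalSpace M] [ChartedSpace H M]
  {W : Type*} [NormedAddCommGroup W] [NormedSpace ℝ W]

/-- The exterior derivative of a `W`-valued one-form, evaluated on vector fields:
`dα(X, Y) = X(α(Y)) - Y(α(X)) - α([X, Y])` (without a factor `1/2`). -/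
def formDeriv (α : ∀ x : M, TangentSpace I x →L[ℝ] W) (X Y : ∀ x : M, TangentSpace I x) (x : M) : W :=
  mvfderiv I (fun y => α y (Y y)) x (X x) - mvfderiv I (fun y => α y (X y)) x (Y x) -
    α x (mlieBracket I X Y x)

/-- The Nijenhuis torsion of a field of endomorphisms, evaluated on vector fields:
`[T, T](X, Y) = T²[X, Y] + [TX, TY] - T[TX, Y] - T[X, TY]`. -/
def nijenhuis (T : ∀ x : M, TangentSpace I x →L[ℝ] TangentSpace I x)
    (X Y : ∀ x : M, TangentSpace I x) (x : M) : TangentSpace I x :=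
  T x (T x (mlieBracket I X Y x)) + mlieBracket I (fun y => T y (X y)) (fun y => T y (Y y)) x -
    T x (mlieBracket I (fun y => T y (X y)) Y x) - T x (mlieBracket I X (fun y => T y (Y y)) x)

variable [IsManifold I ∞ M]

/-- Smooth vector fields. -/
def IsSmoothField (X : ∀ x : M, TangentSpace I x) : Prop :=
  ContMDiff I I.tangent ∞ (fun x => (⟨x, X x⟩ : TangentBundle I M))

/-- Smooth one-forms. -/
def IsSmoothForm (α : ∀ x : M, TangentSpace I x →L[ℝ] ℝ) : Prop :=
  ContMDiff I (I.prod 𝓘(ℝ, E →L[ℝ] ℝ)) ∞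
    (fun x => TotalSpace.mk' (E →L[ℝ] ℝ)
      (E := fun x : M => TangentSpace I x →L[ℝ] Bundle.Trivial M ℝ x) x (α x))

/-- Smooth fields of endomorphisms of the tangent spaces. -/
def IsSmoothEndo (T : ∀ x : M, TangentSpace I x →L[ℝ] TangentSpace I x) : Prop :=
  ContMDiff I (I.prod 𝓘(ℝ, E →L[ℝ] E)) ∞
    (fun x => TotalSpace.mk' (E →L[ℝ] E)
      (E := fun x : M => TangentSpace I x →L[ℝ] TangentSpace I x) x (T x))

/-- `J` is an integrable almost complex structure: it is smooth, satisfies `J² = -1`, and its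
Nijenhuis tensor vanishes. -/
structure IsIntegrableAlmostComplex (J : ∀ x : M, TangentSpace I x →L[ℝ] TangentSpace I x) :
    Prop where
  smooth : IsSmoothEndo I J
  sq : ∀ x v, J x (J x v) = -v
  nijenhuis_eq_zero : ∀ X Y : ∀ x : M, TangentSpace I x, IsSmoothField I X → IsSmoothField I Y →
    ∀ x, nijenhuis I J X Y x = 0

end Tensors

/-! ### Sasakian structures -/

/-- A Sasakian structure `(φ, ξ, η, g)` on `B`: a normal contact metric structure. The contact
condition reads `dη(X, Y) = g(X, φY)` and normality `[φ, φ] + 2 dη ⊗ ξ = 0` with the convention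
`2 dη(X, Y) = X(η(Y)) - Y(η(X)) - η([X, Y])`; `formDeriv` is twice that `dη`. -/
structure SasakianStructure (m : ℕ) (B : Type*) [TopologicalSpace B]
    [ChartedSpace (EuclideanSpace ℝ (Fin m)) B] [IsManifold (𝓡 m) ∞ B] where
  /-- the Riemannian metric -/
  metric : ContMDiffRiemannianMetric (𝓡 m) ∞ (EuclideanSpace ℝ (Fin m))
    (fun b : B => TangentSpace (𝓡 m) b)
  /-- the structure endomorphism -/
  φ : ∀ b : B, TangentSpace (𝓡 m) b →L[ℝ] TangentSpace (𝓡 m) b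
  /-- the characteristic vector field -/
  ξ : ∀ b : B, TangentSpace (𝓡 m) b
  /-- the contact form -/
  η : ∀ b : B, TangentSpace (𝓡 m) b →L[ℝ] ℝ
  smooth_φ : IsSmoothEndo (𝓡 m) φ
  smooth_ξ : IsSmoothField (𝓡 m) ξ
  smooth_η : IsSmoothForm (𝓡 m) η
  η_ξ : ∀ b, η b (ξ b) = 1
  φ_sq : ∀ b v, φ b (φ b v) = -v + η b v • ξ b
  compatible : ∀ b v w, metric.inner b (φ b v) (φ b w) = metric.inner b v w - η b v * η b w
  contact : ∀ X Y : ∀ b : B, TangentSpace (𝓡 m) b, IsSmoothField (𝓡 m) X → IsSmoothField (𝓡 m) Y →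
    ∀ b, formDeriv (𝓡 m) η X Y b = 2 * metric.inner b (X b) (φ b (Y b))
  normal : ∀ X Y : ∀ b : B, TangentSpace (𝓡 m) b, IsSmoothField (𝓡 m) X → IsSmoothField (𝓡 m) Y →
    ∀ b, nijenhuis (𝓡 m) φ X Y b + formDeriv (𝓡 m) η X Y b • ξ b = 0

/-! ### The connection, its curvature, and the almost complex structure -/

/-- The imaginary units `i, j, k`. -/
def imagUnit : Fin 3 → ℍ := ![⟨0, 1, 0, 0⟩, ⟨0, 0, 1, 0⟩, ⟨0, 0, 0, 1⟩]

/-- The one-parameter subgroups `t ↦ exp(-t i)`, `exp(-t j)`, `exp(-t k)` of `S³`. -/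
def oneParam (a : Fin 3) (t : ℝ) : S3 :=
  ⟨NormedSpace.exp (-(t • imagUnit a)), by
    have h : (imagUnit a).re = 0 := by fin_cases a <;> rfl
    rw [mem_sphere_zero_iff_norm, Quaternion.norm_exp, Quaternion.re_neg, Quaternion.re_smul, h]
    simp⟩

namespace InducedBundle

variable [IsManifold (𝓡 m) ∞ B] (ι : C^∞⟮𝓡 m, B; 𝓘(ℝ, Fin n → ℍ), HP n⟯)

/-- The vertical vector field `ξ₁`, `ξ₂`, `ξ₃` (for `a = 0, 1, 2`) on the induced bundle: the
velocity at `t = 0` of `t ↦ exp(-t i)·p`, `exp(-t j)·p`, `exp(-t k)·p`. In terms of the vector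
`h ∈ S⁴ⁿ⁺³` belonging to `p` these are `-i h`, `-j h`, `-k h`. -/
def vert (a : Fin 3) (p : InducedBundle ι) : TangentSpace ((𝓡 m).prod (𝓡 3)) p :=
  mfderiv 𝓘(ℝ, ℝ) ((𝓡 m).prod (𝓡 3)) (fun t : ℝ => act ι (oneParam a t) p) 0 (1 : ℝ)

/-- The differential of the bundle projection. -/
def dproj (p : InducedBundle ι) : TangentSpace ((𝓡 m).prod (𝓡 3)) p →L[ℝ] TangentSpace (𝓡 m) (proj ι p) :=
  mfderiv ((𝓡 m).prod (𝓡 3)) (𝓡 m) (proj ι) p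

/-- The connection form `ω(v) = ∑ⱼ dhⱼ(v) h̄ⱼ` on the induced bundle, with values in
`sp(1) = Im ℍ`: the pull-back of the canonical connection of the Hopf bundle, whose horizontal
spaces are the orthogonal complements of the fibres in `S⁴ⁿ⁺³`. -/
def connForm (p : InducedBundle ι) : TangentSpace ((𝓡 m).prod (𝓡 3)) p →L[ℝ] ℍ :=
  (∑ j : Fin (n + 1), ((ContinuousLinearMap.mul ℝ ℍ).flip (star (toVec ι p j))).comp
    (PiLp.proj 2 (fun _ : Fin (n + 1) => ℍ) j : HVec n →L[ℝ] ℍ)).comp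
    (mvfderiv ((𝓡 m).prod (𝓡 3)) (toVec ι) p)

/-- The one-forms `η̂₁, η̂₂, η̂₃` on the induced bundle, which vanish on horizontal vectors and are
dual to `ξ₁, ξ₂, ξ₃`; they are given by `ω = -(η̂₁ i + η̂₂ j + η̂₃ k)`. -/
def etaHat (a : Fin 3) (p : InducedBundle ι) : TangentSpace ((𝓡 m).prod (𝓡 3)) p →L[ℝ] ℝ :=
  -((innerSL ℝ (imagUnit a)).comp (connForm ι p))

/-- The horizontal lift `w* ∈ T_p P` of `w ∈ T_{π(p)} B`: the vector with `dπ(w*) = w` and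
`η̂₁(w*) = η̂₂(w*) = η̂₃(w*) = 0`. It is expressed by means of the inverse of the isomorphism
`(dπ, η̂) : T_p P → T_{π(p)} B × ℝ³`. -/
def hlift (p : InducedBundle ι) : TangentSpace (𝓡 m) (proj ι p) →L[ℝ] TangentSpace ((𝓡 m).prod (𝓡 3)) p :=
  ((dproj ι p).prod (ContinuousLinearMap.pi fun a => etaHat ι a p)).inverse.comp
    (ContinuousLinearMap.inl ℝ (TangentSpace (𝓡 m) (proj ι p)) (Fin 3 → ℝ))

/-- The horizontal lift `X*` of a vector field `X` on `B`. -/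
def liftField (X : ∀ b : B, TangentSpace (𝓡 m) b) (p : InducedBundle ι) :
    TangentSpace ((𝓡 m).prod (𝓡 3)) p :=
  hlift ι p (X (proj ι p))

/-- The horizontal part of a vector field on the induced bundle. -/
def horPart (A : ∀ p : InducedBundle ι, TangentSpace ((𝓡 m).prod (𝓡 3)) p) (p : InducedBundle ι) :
    TangentSpace ((𝓡 m).prod (𝓡 3)) p :=
  hlift ι p (dproj ι p (A p))

/-- The `sp(1)`-valued curvature form of the connection, evaluated on vector fields:
`Ω(A, A') = dω(hor A, hor A')`. -/
def curvature (A A' : ∀ p : InducedBundle ι, TangentSpace ((𝓡 m).prod (𝓡 3)) p) (p : InducedBundle ι) : ℍ :=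
  formDeriv ((𝓡 m).prod (𝓡 3)) (connForm ι) (horPart ι A) (horPart ι A') p

/-- The almost complex structure with `J ξ₁ = ξ₂`, `J ξ₂ = -ξ₁`, `J ξ₃ = ξ*`, `J ξ* = -ξ₃` and
`J X* = (φ X)*` for `X ⊥ ξ`. Since `v = ∑ η̂ₐ(v) ξₐ + (dπ v)*` and `φ ξ = 0`, it is given by
`J v = η̂₁(v) ξ₂ - η̂₂(v) ξ₁ + η̂₃(v) ξ* - η(dπ v) ξ₃ + (φ (dπ v))*`. -/
def acs (S : SasakianStructure m B) (p : InducedBundle ι) :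
    TangentSpace ((𝓡 m).prod (𝓡 3)) p →L[ℝ] TangentSpace ((𝓡 m).prod (𝓡 3)) p :=
  (etaHat ι 0 p).smulRight (vert ι 1 p) - (etaHat ι 1 p).smulRight (vert ι 0 p) +
    (etaHat ι 2 p).smulRight (liftField ι S.ξ p) -
    ((S.η (proj ι p)).comp (dproj ι p)).smulRight (vert ι 2 p) +
    (hlift ι p).comp ((S.φ (proj ι p)).comp (dproj ι p))

end InducedBundle

end HopfSasaki

end

open HopfSasaki

noncomputable section

set_option linter.unusedSectionVars false

namespace HopfSasaki

/-! ### Calculus of vector fields and one-forms on manifolds. -/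

section Generic

open Filter Topology

variable {E : Type*} [NormedAddCommGroup E] [NormedSpace ℝ E] {H : Type*} [TopologicalSpace H]
  {I : ModelWithCorners ℝ E H} {M : Type*} [TopologicalSpace M] [ChartedSpace H M]
  {E' : Type*} [NormedAddCommGroup E'] [NormedSpace ℝ E'] {H' : Type*} [TopologicalSpace H']
  {I' : ModelWithCorners ℝ E' H'} {M' : Type*} [TopologicalSpace M'] [ChartedSpace H' M']
  {W : Type*} [NormedAddCommGroup W] [NormedSpace ℝ W]

/-! The Nijenhuis tensor `N` of `J` is tensorial and skew, and `J² = -1` makes it complex antilinear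
in each slot: `N(Jv, w) = -J N(v, w)`. Since `ξ₂ = Jξ₁` and `ξ* = Jξ₃`, the vectors `ξ₁`, `ξ₃` and
the lifts `X*` with `X ⊥ ξ` generate each tangent space over `J`, so it suffices to see that `N`
vanishes on pairs of these (`eq_zero_of_antilinear`). By skewness four kinds of pairs remain, and on
them `N` is an expression in Lie brackets.

A tangent vector of `P` is determined by its projection to `B` and its three vertical components
`η̂ₐ` (`tangent_ext`). The projection of a bracket is the bracket of the projections. Its vertical
components come from `ω = ⟨dh, h⟩`, where `⟨u, v⟩ = ∑ uⱼ v̄ⱼ`: since `d²h = 0`, fields `A`, `A'`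
with constant `ω(A)`, `ω(A')` satisfy `ω([A, A']) = ⟨dh A, dh A'⟩ - ⟨dh A', dh A⟩`
(`connForm_mlieBracket`). Hence `[ξₐ, X*] = 0`, the `ξₐ` bracket like `sp(1)`, and `ω([X*, Y*]) =
-Ω(X*, Y*)`.

The four cases are then as follows. For `(ξ₁, ξ₃)` the `sp(1)` relations cancel. For `(ξ₁, X*)` all
brackets vanish. For `(ξ₃, X*)` what remains is `[ξ*, (φX)*] - J[ξ*, X*]`; since `Ω(X*, ξ*) = 0`
these brackets are horizontal, and the difference vanishes because normality makes `φ` invariant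
under the flow of `ξ`. For `(X*, Y*)` the horizontal part is the normality of `S`, the components
along `ξ₁` and `ξ₂` vanish by the `φ`-invariance of `Ω`, and the component along `ξ₃` vanishes by
that invariance together with the contact condition.

Smoothness of `J` rests on the same frame: the map `(dπ, η̂)` is smooth and invertible, and
inversion of operators is smooth, so a field on `P` is smooth as soon as its components are
(`isSmoothFieldAt_of_dproj_etaHat`). -/

theorem mvfderiv_comp_apply' {f : M' → W} {g : M → M'} {x : M}
    (hf : MDifferentiableAt I' 𝓘(ℝ, W) f (g x)) (hg : MDifferentiableAt I I' g x)
    (v : TangentSpace I x) :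
    mvfderiv I (fun y => f (g y)) x v = mvfderiv I' f (g x) (mfderiv I I' g x v) :=
  mfderiv_comp_apply x hf hg v

theorem mvfderiv_congr {f g : M → W} {x : M} (h : f =ᶠ[𝓝 x] g) (v : TangentSpace I x) :
    mvfderiv I f x v = mvfderiv I g x v := by
  have := h.mfderiv_eq (I := I) (I' := 𝓘(ℝ, W))
  exact congrArg (fun L : E →L[ℝ] W => L v) this

/-- A family of continuous linear maps on a finite-dimensional space is smooth if its values on all
vectors are smooth. -/
theorem contMDiffAt_clm_of_apply {V : Type*} [NormedAddCommGroup V] [NormedSpace ℝ V]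
    [FiniteDimensional ℝ V] {Φ : M → V →L[ℝ] W} {x : M}
    (hΦ : ∀ v, ContMDiffAt I 𝓘(ℝ, W) ∞ (fun y => Φ y v) x) :
    ContMDiffAt I 𝓘(ℝ, V →L[ℝ] W) ∞ Φ x := by
  let b := Module.finBasis ℝ V
  let L : (Fin (Module.finrank ℝ V) → W) →L[ℝ] (V →L[ℝ] W) :=
    ∑ i, ContinuousLinearMap.comp
      (ContinuousLinearMap.smulRightL ℝ V W (LinearMap.toContinuousLinearMap (b.coord i)))
      (ContinuousLinearMap.proj i : (Fin (Module.finrank ℝ V) → W) →L[ℝ] W)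
  have hL : ∀ A : V →L[ℝ] W, L (fun i => A (b i)) = A := by
    intro A
    ext v
    have : L (fun i => A (b i)) v = ∑ i, b.coord i v • A (b i) := by
      simp [L]
    rw [this]
    conv_rhs => rw [← b.sum_repr v, map_sum]
    simp
  have h3 : ContMDiffAt I 𝓘(ℝ, Fin (Module.finrank ℝ V) → W) ∞ (fun y i => Φ y (b i)) x :=
    contMDiffAt_pi_space.2 fun i => hΦ (b i)
  have h4 := (L.contMDiff (n := ∞)).contMDiffAt.comp x h3
  refine h4.congr_of_eventuallyEq (Eventually.of_forall fun y => ?_)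
  exact (hL (Φ y)).symm

/-- The product rule for a continuous bilinear map. -/
theorem mvfderiv_bilinear {W₁ W₂ : Type*} [NormedAddCommGroup W₁] [NormedSpace ℝ W₁]
    [NormedAddCommGroup W₂] [NormedSpace ℝ W₂] (L : W₁ →L[ℝ] W₂ →L[ℝ] W) {f : M → W₁} {g : M → W₂}
    {x : M} (hf : MDifferentiableAt I 𝓘(ℝ, W₁) f x) (hg : MDifferentiableAt I 𝓘(ℝ, W₂) g x)
    (v : TangentSpace I x) :
    mvfderiv I (fun y => L (f y) (g y)) x v =
      L (mvfderiv I f x v) (g x) + L (f x) (mvfderiv I g x v) := by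
  have hx : (extChartAt I x).symm (extChartAt I x x) = x := extChartAt_to_inv x
  have h1 := L.hasFDerivWithinAt_of_bilinear hf.hasMFDerivAt.2 hg.hasMFDerivAt.2
  have h2 : HasMFDerivAt I 𝓘(ℝ, W) (fun y => L (f y) (g y)) x
      (L.precompR E (f x) (mfderiv I 𝓘(ℝ, W₂) g x) + L.precompL E (mfderiv I 𝓘(ℝ, W₁) f x) (g x)) := by
    refine ⟨L.isBoundedBilinearMap.continuous.continuousAt.comp
      (hf.continuousAt.prodMk hg.continuousAt), ?_⟩
    simpa [writtenInExtChartAt, hx] using! h1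
  have h3 : mvfderiv I (fun y => L (f y) (g y)) x v = (L.precompR E (f x) (mfderiv I 𝓘(ℝ, W₂) g x) +
      L.precompL E (mfderiv I 𝓘(ℝ, W₁) f x) (g x)) v :=
    congrArg (fun A : E →L[ℝ] W => A v) h2.mfderiv
  rw [h3, add_comm]
  rfl

variable [IsManifold I' ∞ M']

theorem IsSmoothForm.apply_comp {α : ∀ x : M', TangentSpace I' x →L[ℝ] ℝ}
    (hα : IsSmoothForm I' α) {F : M → M'} {x : M} (hF : ContMDiffAt I I' ∞ F x)
    {X : ∀ x : M, TangentSpace I' (F x)}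
    (hX : ContMDiffAt I I'.tangent ∞ (fun y => (⟨F y, X y⟩ : TangentBundle I' M')) x) :
    ContMDiffAt I 𝓘(ℝ, ℝ) ∞ (fun y => α (F y) (X y)) x := by
  have h1 := ((hα (F x)).comp x hF)
  have h2 := ContMDiffAt.clm_bundle_apply (E₂ := Bundle.Trivial M' ℝ) (b := F) h1 hX
  rw [contMDiffAt_totalSpace] at h2
  exact h2.2

theorem IsSmoothEndo.apply_comp {T : ∀ x : M', TangentSpace I' x →L[ℝ] TangentSpace I' x}
    (hT : IsSmoothEndo I' T) {F : M → M'} {x : M} (hF : ContMDiffAt I I' ∞ F x)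
    {X : ∀ x : M, TangentSpace I' (F x)}
    (hX : ContMDiffAt I I'.tangent ∞ (fun y => (⟨F y, X y⟩ : TangentBundle I' M')) x) :
    ContMDiffAt I I'.tangent ∞ (fun y => (⟨F y, T (F y) (X y)⟩ : TangentBundle I' M')) x :=
  ContMDiffAt.clm_bundle_apply (b := F) ((hT (F x)).comp x hF) hX

variable [IsManifold I ∞ M]

variable (I) in
/-- Smoothness of a vector field at a point. -/
def IsSmoothFieldAt (X : ∀ x : M, TangentSpace I x) (x : M) : Prop :=
  ContMDiffAt I I.tangent ∞ (fun y => (⟨y, X y⟩ : TangentBundle I M)) x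

theorem IsSmoothField.smoothAt {X : ∀ x : M, TangentSpace I x} (hX : IsSmoothField I X) (x : M) :
    IsSmoothFieldAt I X x :=
  hX x

theorem IsSmoothFieldAt.mdifferentiableAt {X : ∀ x : M, TangentSpace I x} {x : M}
    (hX : IsSmoothFieldAt I X x) :
    MDifferentiableAt I I.tangent (fun y => (⟨y, X y⟩ : TangentBundle I M)) x :=
  ContMDiffAt.mdifferentiableAt hX (by simp)

/-- The differential of a smooth map, applied to a smooth vector field, is a smooth map to the
tangent bundle. -/
theorem contMDiffAt_mfderiv_apply {f : M → M'} {x : M} (hf : ContMDiffAt I I' ∞ f x)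
    {X : ∀ x : M, TangentSpace I x} (hX : IsSmoothFieldAt I X x) :
    ContMDiffAt I I'.tangent ∞
      (fun y => (⟨f y, mfderiv I I' f y (X y)⟩ : TangentBundle I' M')) x :=
  ContMDiffAt.clm_apply_of_inCoordinates (b₁ := id) (b₂ := f)
    (hf.mfderiv_const (m := ∞) (by simp)) hX hf

theorem contMDiffAt_mvfderiv_apply {f : M → W} {x : M} (hf : ContMDiffAt I 𝓘(ℝ, W) ∞ f x)
    {X : ∀ x : M, TangentSpace I x} (hX : IsSmoothFieldAt I X x) :
    ContMDiffAt I 𝓘(ℝ, W) ∞ (fun y => mvfderiv I f y (X y)) x :=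
  (contMDiff_snd_tangentBundle_modelSpace W 𝓘(ℝ, W)).contMDiffAt.comp x
    (contMDiffAt_mfderiv_apply hf hX)

/-- `d²f = 0`, for a vector valued function `f`. -/
theorem mvfderiv_mlieBracket [CompleteSpace E] [I.Boundaryless] {f : M → W} {x : M}
    (hf : ContMDiffAt I 𝓘(ℝ, W) ∞ f x) {X Y : ∀ x : M, TangentSpace I x}
    (hX : IsSmoothFieldAt I X x) (hY : IsSmoothFieldAt I Y x) :
    mvfderiv I f x (mlieBracket I X Y x) =
      mvfderiv I (fun y => mvfderiv I f y (Y y)) x (X x) -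
        mvfderiv I (fun y => mvfderiv I f y (X y)) x (Y x) := by
  -- Everything is pulled back to the model space along the inverse chart `g`. There the identity is
  -- the symmetry of the second derivative, `fderiv_apply_lieBracket`.
  let g : E → M := fun y => (extChartAt I x).symm y
  let y₀ : E := extChartAt I x x
  have hgy : g y₀ = x := extChartAt_to_inv x
  have hopen : IsOpen (extChartAt I x).target := isOpen_extChartAt_target x
  have hmem : (extChartAt I x).target ∈ 𝓝 y₀ := hopen.mem_nhds (mem_extChartAt_target x)
  have hg : ∀ y ∈ (extChartAt I x).target, ContMDiffAt 𝓘(ℝ, E) I ∞ g y := fun y hy =>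
    (contMDiffOn_extChartAt_symm x).contMDiffAt (hopen.mem_nhds hy)
  have hinv : ∀ y ∈ (extChartAt I x).target, (mfderiv 𝓘(ℝ, E) I g y).IsInvertible := fun y hy => by
    have := isInvertible_mfderivWithin_extChartAt_symm (I := I) hy
    rwa [I.range_eq_univ, mfderivWithin_univ] at this
  have hpull : ∀ (Z : ∀ x : M, TangentSpace I x), ∀ y ∈ (extChartAt I x).target,
      mfderiv 𝓘(ℝ, E) I g y (mpullback 𝓘(ℝ, E) I g Z y) = Z (g y) := fun Z y hy => by
    obtain ⟨e, he⟩ := hinv y hy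
    rw [mpullback_apply, ← he]
    simp
  have hfy : ∀ᶠ y in 𝓝 y₀, MDifferentiableAt I 𝓘(ℝ, W) f (g y) := by
    have h1 : ∀ᶠ z in 𝓝 x, ContMDiffAt I 𝓘(ℝ, W) 1 f z :=
      (contMDiffAt_iff_contMDiffAt_nhds (by simp)).1 (ContMDiffAt.of_le hf (by simp))
    have h2 : Tendsto g (𝓝 y₀) (𝓝 x) := by
      have := (hg y₀ (mem_extChartAt_target x)).continuousAt
      rwa [ContinuousAt, hgy] at this
    filter_upwards [h2.eventually h1] with y hy using hy.mdifferentiableAt one_ne_zero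
  have hcomp : ∀ Z : ∀ x : M, TangentSpace I x, ∀ᶠ y in 𝓝 y₀,
      fderiv ℝ (fun y => f (g y)) y (mpullback 𝓘(ℝ, E) I g Z y) = mvfderiv I f (g y) (Z (g y)) :=
    fun Z => by
      filter_upwards [hfy, hmem] with y hy hy'
      have := mvfderiv_comp_apply' hy ((hg y hy').mdifferentiableAt (by simp))
        (mpullback 𝓘(ℝ, E) I g Z y)
      rw [hpull Z y hy'] at this
      rw [← this, mvfderiv, mfderiv_eq_fderiv]
      rfl
  have hdiff : ∀ Z : ∀ x : M, TangentSpace I x, IsSmoothFieldAt I Z x →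
      DifferentiableAt ℝ (mpullback 𝓘(ℝ, E) I g Z) y₀ := fun Z hZ => by
    have h1 : ContMDiffAt 𝓘(ℝ, E) 𝓘(ℝ, E).tangent ∞
        (fun y => (⟨y, mpullback 𝓘(ℝ, E) I g Z y⟩ : TangentBundle 𝓘(ℝ, E) E)) y₀ := by
      refine ContMDiffAt.mpullback_vectorField_preimage (n := ∞) ?_
        (hg y₀ (mem_extChartAt_target x)) (hinv y₀ (mem_extChartAt_target x)) (by simp)
      rw [hgy]
      exact hZ
    have h2 := (contMDiff_snd_tangentBundle_modelSpace E 𝓘(ℝ, E)).contMDiffAt.comp y₀ h1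
    exact (contMDiffAt_iff_contDiffAt.1 h2).differentiableAt (by simp)
  have hfg : ContDiffAt ℝ ∞ (fun y => f (g y)) y₀ :=
    contMDiffAt_iff_contDiffAt.1
      (ContMDiffAt.comp y₀ (by rw [hgy]; exact hf) (hg y₀ (mem_extChartAt_target x)))
  -- The iterated derivatives on the manifold agree with those in the chart.
  have hF : ∀ Z : ∀ x : M, TangentSpace I x, IsSmoothFieldAt I Z x →
      ∀ Z' : ∀ x : M, TangentSpace I x,
      fderiv ℝ (fun y => fderiv ℝ (fun y => f (g y)) y (mpullback 𝓘(ℝ, E) I g Z y)) y₀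
        (mpullback 𝓘(ℝ, E) I g Z' y₀) = mvfderiv I (fun y => mvfderiv I f y (Z y)) x (Z' x) :=
    fun Z hZ Z' => by
      rw [Filter.EventuallyEq.fderiv_eq (hcomp Z)]
      have h1 : MDifferentiableAt I 𝓘(ℝ, W) (fun y => mvfderiv I f y (Z y)) (g y₀) := by
        rw [hgy]
        exact (contMDiffAt_mvfderiv_apply hf hZ).mdifferentiableAt (by simp)
      have h2 := mvfderiv_comp_apply' h1
        ((hg y₀ (mem_extChartAt_target x)).mdifferentiableAt (by simp))
        (mpullback 𝓘(ℝ, E) I g Z' y₀)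
      rw [hpull Z' y₀ (mem_extChartAt_target x), hgy] at h2
      rw [← h2, mvfderiv, mfderiv_eq_fderiv]
      rfl
  have h2 : (2 : ℕ∞ω) ≤ ∞ := WithTop.coe_le_coe.2 (le_top : (2 : ℕ∞) ≤ ⊤)
  have : IsManifold I (minSmoothness ℝ 2) M := IsManifold.of_le (n := ∞) (by simpa using h2)
  have hbr : lieBracket ℝ (mpullback 𝓘(ℝ, E) I g X) (mpullback 𝓘(ℝ, E) I g Y) y₀ =
      mpullback 𝓘(ℝ, E) I g (mlieBracket I X Y) y₀ := by
    rw [mpullback_mlieBracket (n := ∞) (by rw [hgy]; exact hX.mdifferentiableAt)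
      (by rw [hgy]; exact hY.mdifferentiableAt) (hg y₀ (mem_extChartAt_target x)) (by simpa using h2),
      ← mlieBracketWithin_univ, mlieBracketWithin_eq_lieBracketWithin]
    exact (congrFun lieBracketWithin_univ y₀).symm
  have hb := fderiv_apply_lieBracket hfg (by simpa using h2) (hdiff Y hY) (hdiff X hX)
  have hc := (hcomp (mlieBracket I X Y)).self_of_nhds
  rw [hgy] at hc
  calc mvfderiv I f x (mlieBracket I X Y x)
      = fderiv ℝ (fun y => f (g y)) y₀ (mpullback 𝓘(ℝ, E) I g (mlieBracket I X Y) y₀) := hc.symm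
    _ = fderiv ℝ (fun y => f (g y)) y₀
          (lieBracket ℝ (mpullback 𝓘(ℝ, E) I g X) (mpullback 𝓘(ℝ, E) I g Y) y₀) :=
        congrArg (fderiv ℝ (fun y => f (g y)) y₀) hbr.symm
    _ = _ := hb
    _ = _ := congrArg₂ _ (hF Y hY X) (hF X hX Y)

/-- The Lie brackets of related vector fields are related. -/
theorem mfderiv_mlieBracket_of_related [CompleteSpace E] [I.Boundaryless] [CompleteSpace E']
    [I'.Boundaryless] {F : M → M'} {x : M} (hF : ContMDiff I I' ∞ F)
    {X Y : ∀ x : M, TangentSpace I x} {X' Y' : ∀ x : M', TangentSpace I' x}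
    (hX : IsSmoothFieldAt I X x) (hY : IsSmoothFieldAt I Y x)
    (hX' : IsSmoothFieldAt I' X' (F x)) (hY' : IsSmoothFieldAt I' Y' (F x))
    (hXX' : ∀ y, mfderiv I I' F y (X y) = X' (F y))
    (hYY' : ∀ y, mfderiv I I' F y (Y y) = Y' (F y)) :
    mfderiv I I' F x (mlieBracket I X Y x) = mlieBracket I' X' Y' (F x) := by
  -- `F` need not be a local diffeomorphism, so `X'` and `Y'` cannot be pulled back along it.
  -- Instead both sides are tested with the chart `c`, whose differential is injective, and `d² = 0`
  -- is applied to `c` and to `c ∘ F`.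
  let c : M' → E' := fun z => extChartAt I' (F x) z
  have hc : ContMDiffAt I' 𝓘(ℝ, E') ∞ c (F x) := contMDiffAt_extChartAt
  have hFd : ∀ y, MDifferentiableAt I I' F y := fun y => (hF y).mdifferentiableAt (by simp)
  have hcd : ∀ᶠ y in 𝓝 x, MDifferentiableAt I' 𝓘(ℝ, E') c (F y) := by
    have h1 : ∀ᶠ z in 𝓝 (F x), ContMDiffAt I' 𝓘(ℝ, E') 1 c z :=
      (contMDiffAt_iff_contMDiffAt_nhds (by simp)).1 (ContMDiffAt.of_le hc (by simp))
    filter_upwards [hF.continuous.continuousAt.eventually h1] with y hy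
      using hy.mdifferentiableAt one_ne_zero
  have hinj : Function.Injective (mfderiv I' 𝓘(ℝ, E') c (F x)) := by
    obtain ⟨e, he⟩ := isInvertible_mfderiv_extChartAt (I := I') (mem_extChartAt_source (F x))
    change Function.Injective (mfderiv I' 𝓘(ℝ, E') (extChartAt I' (F x)) (F x))
    rw [← he]
    exact e.injective
  have hrel : ∀ (Z : ∀ x : M, TangentSpace I x) (Z' : ∀ x : M', TangentSpace I' x),
      (∀ y, mfderiv I I' F y (Z y) = Z' (F y)) → IsSmoothFieldAt I' Z' (F x) →
      ∀ (V : ∀ x : M, TangentSpace I x) (V' : ∀ x : M', TangentSpace I' x),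
      (∀ y, mfderiv I I' F y (V y) = V' (F y)) →
      mvfderiv I (fun y => mvfderiv I (fun y => c (F y)) y (Z y)) x (V x) =
        mvfderiv I' (fun z => mvfderiv I' c z (Z' z)) (F x) (V' (F x)) := by
    intro Z Z' hZ hZ' V V' hV
    have h1 : (fun y => mvfderiv I (fun y => c (F y)) y (Z y)) =ᶠ[𝓝 x]
        fun y => mvfderiv I' c (F y) (Z' (F y)) := by
      filter_upwards [hcd] with y hy
      rw [mvfderiv_comp_apply' hy (hFd y), hZ]
    rw [mvfderiv_congr h1, mvfderiv_comp_apply' (f := fun z => mvfderiv I' c z (Z' z))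
      ((contMDiffAt_mvfderiv_apply hc hZ').mdifferentiableAt (by simp)) (hFd x), hV]
  have hcF : ContMDiffAt I 𝓘(ℝ, E') ∞ (fun y => c (F y)) x := hc.comp x (hF x)
  apply hinj
  change mvfderiv I' c (F x) (mfderiv I I' F x (mlieBracket I X Y x)) =
    mvfderiv I' c (F x) (mlieBracket I' X' Y' (F x))
  rw [← mvfderiv_comp_apply' hcd.self_of_nhds (hFd x), mvfderiv_mlieBracket hcF hX hY,
    mvfderiv_mlieBracket hc hX' hY']
  exact congrArg₂ _ (hrel Y Y' hYY' hY' X X' hXX') (hrel X X' hXX' hX' Y Y' hYY')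

variable (I) in
/-- The vector field with constant coordinates in a trivialization of the tangent bundle. -/
def coordField (x : M) (v : E) (y : M) : TangentSpace I y :=
  (trivializationAt E (TangentSpace I) x).symm y v

theorem contMDiffOn_coordField (x : M) (v : E) :
    ContMDiffOn I I.tangent ∞ (fun y => (⟨y, coordField I x v y⟩ : TangentBundle I M))
      (trivializationAt E (TangentSpace I) x).baseSet := by
  have hc : ContMDiffOn I 𝓘(ℝ, E) ∞ (fun _ : M => v)
      (trivializationAt E (TangentSpace I) x).baseSet := contMDiffOn_const
  refine ((trivializationAt E (TangentSpace I) x).contMDiffOn_section_iff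
    (trivializationAt E (TangentSpace I) x).open_baseSet subset_rfl).2 (hc.congr fun y hy => ?_)
  rw [coordField, (trivializationAt E (TangentSpace I) x).mk_symm hy,
    (trivializationAt E (TangentSpace I) x).apply_symm_apply']
  exact hy

theorem isSmoothFieldAt_coordField (x : M) (v : E) : IsSmoothFieldAt I (coordField I x v) x :=
  (contMDiffOn_coordField x v).contMDiffAt
    ((trivializationAt E (TangentSpace I) x).open_baseSet.mem_nhds
      (FiberBundle.mem_baseSet_trivializationAt' x))

/-- Every tangent vector extends to a global smooth vector field. -/
theorem exists_isSmoothField_eq [FiniteDimensional ℝ E] [T2Space M] (x : M) (v : TangentSpace I x) :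
    ∃ X : ∀ y : M, TangentSpace I y, IsSmoothField I X ∧ X x = v := by
  let e := trivializationAt E (TangentSpace I) x
  have hx : x ∈ e.baseSet := FiberBundle.mem_baseSet_trivializationAt' x
  obtain ⟨ψ⟩ : Nonempty (SmoothBumpFunction I x) := inferInstance
  refine ⟨(ψ : M → ℝ) • coordField I x (e ⟨x, v⟩).2, ?_, ?_⟩
  · refine ContMDiffOn.smul_section_of_tsupport (u := e.baseSet) ψ.contMDiff.contMDiffOn
      e.open_baseSet ?_ (contMDiffOn_coordField x _)
    -- The base set of the trivialization is the chart domain, which contains the closed support of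
    -- the bump function.
    exact ψ.tsupport_subset_chartAt_source
  · change ψ x • coordField I x (e ⟨x, v⟩).2 x = v
    rw [ψ.eq_one, one_smul, coordField]
    exact e.symm_apply_apply_mk hx v

/-- A field of endomorphisms which takes smooth vector fields to smooth vector fields is smooth. -/
theorem isSmoothEndo_of_apply [FiniteDimensional ℝ E]
    {T : ∀ x : M, TangentSpace I x →L[ℝ] TangentSpace I x}
    (h : ∀ x (X : ∀ x : M, TangentSpace I x), IsSmoothFieldAt I X x →
      IsSmoothFieldAt I (fun y => T y (X y)) x) : IsSmoothEndo I T := by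
  intro x
  rw [contMDiffAt_hom_bundle]
  refine ⟨contMDiffAt_id, ?_⟩
  let e := trivializationAt E (TangentSpace I) x
  have hx : x ∈ e.baseSet := FiberBundle.mem_baseSet_trivializationAt' x
  let Φ : M → E →L[ℝ] E := fun y => ContinuousLinearMap.inCoordinates E (TangentSpace I) E
    (TangentSpace I) x y x y (T y)
  -- In coordinates `Φ y v` is the value of `T` on the field with constant coordinates `v`, which is
  -- smooth near `x`.
  have hΦ : ∀ v, ContMDiffAt I 𝓘(ℝ, E) ∞ (fun y => Φ y v) x := by
    intro v
    have h1 := (e.contMDiffAt_section_iff hx).1 (h x _ (isSmoothFieldAt_coordField x v))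
    refine h1.congr_of_eventuallyEq ?_
    filter_upwards [e.open_baseSet.mem_nhds hx] with y hy
    change e.continuousLinearMapAt ℝ y (T y (e.symmL ℝ y v)) = _
    rw [e.continuousLinearMapAt_apply (R := ℝ), e.coe_linearMapAt_of_mem (R := ℝ) hy,
      e.symmL_apply (R := ℝ) hy]
    rfl
  exact contMDiffAt_clm_of_apply hΦ

theorem IsSmoothEndo.apply {T : ∀ x : M, TangentSpace I x →L[ℝ] TangentSpace I x}
    (hT : IsSmoothEndo I T) {x : M} {X : ∀ x : M, TangentSpace I x} (hX : IsSmoothFieldAt I X x) :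
    IsSmoothFieldAt I (fun y => T y (X y)) x :=
  ContMDiffAt.clm_bundle_apply (b := id) (hT x) hX

theorem IsSmoothForm.apply {α : ∀ x : M, TangentSpace I x →L[ℝ] ℝ}
    (hα : IsSmoothForm I α) {x : M} {X : ∀ x : M, TangentSpace I x} (hX : IsSmoothFieldAt I X x) :
    ContMDiffAt I 𝓘(ℝ, ℝ) ∞ (fun y => α y (X y)) x :=
  hα.apply_comp (F := id) contMDiffAt_id hX

end Generic

/-! ### The Nijenhuis torsion as a tensor. -/

section Nijenhuis

variable {E : Type*} [NormedAddCommGroup E] [NormedSpace ℝ E] {H : Type*} [TopologicalSpace H]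
  {I : ModelWithCorners ℝ E H} {M : Type*} [TopologicalSpace M] [ChartedSpace H M]

theorem nijenhuis_swap (T : ∀ x : M, TangentSpace I x →L[ℝ] TangentSpace I x)
    (X Y : ∀ x : M, TangentSpace I x) (x : M) :
    nijenhuis I T X Y x = -nijenhuis I T Y X x := by
  simp only [nijenhuis]
  rw [mlieBracket_swap_apply (V := X) (W := Y),
    mlieBracket_swap_apply (V := fun y => T y (X y)) (W := fun y => T y (Y y)),
    mlieBracket_swap_apply (V := fun y => T y (X y)) (W := Y),
    mlieBracket_swap_apply (V := X) (W := fun y => T y (Y y))]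
  simp only [map_neg]
  abel

variable [IsManifold I ∞ M]

theorem IsSmoothEndo.mdifferentiableAt_apply
    {T : ∀ x : M, TangentSpace I x →L[ℝ] TangentSpace I x} (hT : IsSmoothEndo I T) {x : M}
    {X : ∀ x : M, TangentSpace I x}
    (hX : MDifferentiableAt I I.tangent (fun y => (⟨y, X y⟩ : TangentBundle I M)) x) :
    MDifferentiableAt I I.tangent (fun y => (⟨y, T y (X y)⟩ : TangentBundle I M)) x :=
  MDifferentiableAt.clm_bundle_apply (b := id) ((hT x).mdifferentiableAt (by simp)) hX

/-- Evaluating a tensor at a point only needs extensions that are smooth there, so no bump function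
and no separation axiom enters. -/
theorem exists_isSmoothFieldAt_eq (x : M) (v : TangentSpace I x) :
    ∃ X : ∀ y : M, TangentSpace I y, IsSmoothFieldAt I X x ∧ X x = v :=
  ⟨coordField I x _, isSmoothFieldAt_coordField x _,
    (trivializationAt E (TangentSpace I) x).symm_apply_apply_mk
      (FiberBundle.mem_baseSet_trivializationAt' x) v⟩

variable [CompleteSpace E]

/-- Replacing `X` by `fX` produces the extra terms `-(Yf) T²X` from `T²[fX, Y]`, `-((TY)f) TX` from
`[T(fX), TY]`, and their negatives from the last two brackets; they cancel in pairs. -/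
theorem tensorialAt_nijenhuis {T : ∀ x : M, TangentSpace I x →L[ℝ] TangentSpace I x}
    (hT : IsSmoothEndo I T) {x : M} (Y : ∀ x : M, TangentSpace I x) :
    TensorialAt I E (fun X : ∀ x : M, TangentSpace I x => nijenhuis I T X Y x) x where
  smul {f X} hf hX := by
    have h2 : (2 : ℕ∞ω) ≤ ∞ := WithTop.coe_le_coe.2 (le_top : (2 : ℕ∞) ≤ ⊤)
    have : IsManifold I 2 M := IsManifold.of_le (n := ∞) h2
    have hTX := hT.mdifferentiableAt_apply hX
    have hTf : (fun y => T y ((f • X) y)) = f • fun y => T y (X y) := by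
      funext y
      exact (T y).map_smul (f y) (X y)
    simp only [nijenhuis]
    rw [hTf, mlieBracket_smul_left hf hX, mlieBracket_smul_left hf hX,
      mlieBracket_smul_left hf hTX, mlieBracket_smul_left hf hTX]
    simp only [map_add, map_smul, smul_add, smul_sub]
    module
  add {X X'} hX hX' := by
    have h2 : (2 : ℕ∞ω) ≤ ∞ := WithTop.coe_le_coe.2 (le_top : (2 : ℕ∞) ≤ ⊤)
    have : IsManifold I 2 M := IsManifold.of_le (n := ∞) h2
    have hTf : (fun y => T y ((X + X') y)) = (fun y => T y (X y)) + fun y => T y (X' y) := by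
      funext y
      exact (T y).map_add (X y) (X' y)
    simp only [nijenhuis]
    rw [hTf, mlieBracket_add_left hX hX', mlieBracket_add_left hX hX',
      mlieBracket_add_left (hT.mdifferentiableAt_apply hX) (hT.mdifferentiableAt_apply hX'),
      mlieBracket_add_left (hT.mdifferentiableAt_apply hX) (hT.mdifferentiableAt_apply hX')]
    simp only [map_add]
    abel

theorem tensorialAt_nijenhuis_right {T : ∀ x : M, TangentSpace I x →L[ℝ] TangentSpace I x}
    (hT : IsSmoothEndo I T) {x : M} (X : ∀ x : M, TangentSpace I x) :
    TensorialAt I E (fun Y : ∀ x : M, TangentSpace I x => nijenhuis I T X Y x) x where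
  smul {f Y} hf hY := by
    rw [nijenhuis_swap, (tensorialAt_nijenhuis hT X).smul hf hY, nijenhuis_swap T Y X, smul_neg,
      neg_neg]
  add {Y Y'} hY hY' := by
    rw [nijenhuis_swap, (tensorialAt_nijenhuis hT X).add hY hY', nijenhuis_swap T Y X,
      nijenhuis_swap T Y' X, neg_add, neg_neg, neg_neg]

variable [FiniteDimensional ℝ E]

/-- The Nijenhuis tensor of a smooth field of endomorphisms at a point. -/
def nijenhuisAt {T : ∀ x : M, TangentSpace I x →L[ℝ] TangentSpace I x}
    (hT : IsSmoothEndo I T) (x : M) :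
    TangentSpace I x →L[ℝ] TangentSpace I x →L[ℝ] TangentSpace I x :=
  TensorialAt.mkHom₂ (I := I) (F := E) (F' := E)
    (fun X Y : ∀ x : M, TangentSpace I x => nijenhuis I T X Y x) x
    (fun Y _ => tensorialAt_nijenhuis hT Y) fun X _ => tensorialAt_nijenhuis_right hT X

theorem nijenhuisAt_apply {T : ∀ x : M, TangentSpace I x →L[ℝ] TangentSpace I x}
    (hT : IsSmoothEndo I T) {x : M} {X Y : ∀ x : M, TangentSpace I x}
    (hX : IsSmoothFieldAt I X x) (hY : IsSmoothFieldAt I Y x) :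
    nijenhuisAt hT x (X x) (Y x) = nijenhuis I T X Y x :=
  TensorialAt.mkHom₂_apply (I := I) (F := E) (F' := E) _ _ hX.mdifferentiableAt hY.mdifferentiableAt

theorem nijenhuisAt_swap {T : ∀ x : M, TangentSpace I x →L[ℝ] TangentSpace I x}
    (hT : IsSmoothEndo I T) {x : M} (v w : TangentSpace I x) :
    nijenhuisAt hT x v w = -nijenhuisAt hT x w v := by
  obtain ⟨X, hX, rfl⟩ := exists_isSmoothFieldAt_eq x v
  obtain ⟨Y, hY, rfl⟩ := exists_isSmoothFieldAt_eq x w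
  rw [nijenhuisAt_apply hT hX hY, nijenhuisAt_apply hT hY hX, nijenhuis_swap]

theorem nijenhuisAt_self {T : ∀ x : M, TangentSpace I x →L[ℝ] TangentSpace I x}
    (hT : IsSmoothEndo I T) {x : M} (v : TangentSpace I x) : nijenhuisAt hT x v v = 0 := by
  have h : (2 : ℝ) • nijenhuisAt hT x v v = 0 := by
    rw [two_smul]
    exact eq_neg_iff_add_eq_zero.1 (nijenhuisAt_swap hT v v)
  exact (smul_eq_zero.1 h).resolve_left two_ne_zero

/-- The Nijenhuis tensor of an almost complex structure is complex antilinear. -/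
theorem nijenhuisAt_apply_left {T : ∀ x : M, TangentSpace I x →L[ℝ] TangentSpace I x}
    (hT : IsSmoothEndo I T) (hsq : ∀ x v, T x (T x v) = -v) {x : M} (v w : TangentSpace I x) :
    nijenhuisAt hT x (T x v) w = -T x (nijenhuisAt hT x v w) := by
  have h2 : (2 : ℕ∞ω) ≤ ∞ := WithTop.coe_le_coe.2 (le_top : (2 : ℕ∞) ≤ ⊤)
  have : IsManifold I 2 M := IsManifold.of_le (n := ∞) h2
  obtain ⟨X, hX, rfl⟩ := exists_isSmoothFieldAt_eq x v
  obtain ⟨Y, hY, rfl⟩ := exists_isSmoothFieldAt_eq x w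
  rw [nijenhuisAt_apply hT (hT.apply hX) hY, nijenhuisAt_apply hT hX hY]
  -- With `T²X = -X` as fields, `N(TX, Y)` consists of the same four brackets as `-T N(X, Y)`.
  have h1 : (fun y => T y (T y (X y))) = (-1 : ℝ) • X := by
    funext y
    rw [hsq]
    exact (neg_one_smul ℝ (X y)).symm
  simp only [nijenhuis]
  rw [h1, mlieBracket_const_smul_left hX.mdifferentiableAt,
    mlieBracket_const_smul_left hX.mdifferentiableAt]
  simp only [map_add, map_sub, map_smul, hsq, map_neg]
  module

theorem nijenhuisAt_apply_right {T : ∀ x : M, TangentSpace I x →L[ℝ] TangentSpace I x}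
    (hT : IsSmoothEndo I T) (hsq : ∀ x v, T x (T x v) = -v) {x : M} (v w : TangentSpace I x) :
    nijenhuisAt hT x v (T x w) = -T x (nijenhuisAt hT x v w) := by
  rw [nijenhuisAt_swap, nijenhuisAt_apply_left hT hsq, nijenhuisAt_swap hT v w, map_neg]

end Nijenhuis

/-! ### Identities for Sasakian structures. -/

namespace SasakianStructure

variable {m : ℕ} {B : Type*} [TopologicalSpace B] [ChartedSpace (EuclideanSpace ℝ (Fin m)) B]
  [IsManifold (𝓡 m) ∞ B] (S : SasakianStructure m B)

theorem ξ_ne_zero (b : B) : S.ξ b ≠ 0 := by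
  intro h
  have := S.η_ξ b
  rw [h, map_zero] at this
  exact zero_ne_one this

/-- The formula for `φ²` gives `φ²ξ = 0`. Evaluated at `φξ` it then gives `φξ = cξ`, so `0 = φ²ξ =
c²ξ` and `c = 0`. -/
theorem φ_ξ (b : B) : S.φ b (S.ξ b) = 0 := by
  have h1 : S.φ b (S.φ b (S.ξ b)) = 0 := by rw [S.φ_sq, S.η_ξ, one_smul, neg_add_cancel]
  have h2 := S.φ_sq b (S.φ b (S.ξ b))
  rw [h1, map_zero] at h2
  have h3 : S.φ b (S.ξ b) = S.η b (S.φ b (S.ξ b)) • S.ξ b := by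
    rw [← sub_eq_zero, ← neg_eq_zero, neg_sub, sub_eq_neg_add]
    exact h2.symm
  generalize S.η b (S.φ b (S.ξ b)) = c at h3
  rw [h3, map_smul, h3, smul_smul] at h1
  have hc : c = 0 := by simpa [S.ξ_ne_zero b] using h1
  rw [h3, hc, zero_smul]

/-- Computing `φ³v` as `φ(φ²v)` and as `φ²(φv)` gives `-φv` and `-φv + η(φv)ξ`. -/
theorem η_φ (b : B) (v : TangentSpace (𝓡 m) b) : S.η b (S.φ b v) = 0 := by
  have h1 := S.φ_sq b (S.φ b v)
  rw [S.φ_sq b v, map_add, map_neg, map_smul, S.φ_ξ, smul_zero, add_zero] at h1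
  have h2 : S.η b (S.φ b v) • S.ξ b = 0 := by simpa using h1
  exact (smul_eq_zero.1 h2).resolve_right (S.ξ_ne_zero b)

/-- This is compatibility of the metric with second argument `ξ`. It turns orthogonality to `ξ` into
the vanishing of `η`, the form used throughout the proof. -/
theorem inner_ξ (b : B) (v : TangentSpace (𝓡 m) b) : S.metric.inner b v (S.ξ b) = S.η b v := by
  have h := S.compatible b v (S.ξ b)
  rw [S.φ_ξ, map_zero, S.η_ξ, mul_one] at h
  linarith

theorem φ_φ_of_η_eq_zero {b : B} {v : TangentSpace (𝓡 m) b} (hv : S.η b v = 0) :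
    S.φ b (S.φ b v) = -v := by
  rw [S.φ_sq, hv, zero_smul, add_zero]

/-- The field `φ X`. -/
def φField (X : ∀ b : B, TangentSpace (𝓡 m) b) (b : B) : TangentSpace (𝓡 m) b := S.φ b (X b)

theorem isSmoothField_φField {X : ∀ b : B, TangentSpace (𝓡 m) b}
    (hX : IsSmoothField (𝓡 m) X) : IsSmoothField (𝓡 m) (S.φField X) :=
  fun b => S.smooth_φ.apply (hX.smoothAt b)

theorem formDeriv_η {X Y : ∀ b : B, TangentSpace (𝓡 m) b} {c d : ℝ}
    (hX : ∀ b, S.η b (X b) = c) (hY : ∀ b, S.η b (Y b) = d) (b : B) :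
    formDeriv (𝓡 m) S.η X Y b = -S.η b (mlieBracket (𝓡 m) X Y b) := by
  simp only [formDeriv, hX, hY, mvfderiv_const]
  simp

/-- When `η(X)` and `η(Y)` are constant, the contact condition retains only the bracket term of
`dη`. -/
theorem η_mlieBracket {X Y : ∀ b : B, TangentSpace (𝓡 m) b} {c d : ℝ}
    (hXs : IsSmoothField (𝓡 m) X) (hYs : IsSmoothField (𝓡 m) Y)
    (hX : ∀ b, S.η b (X b) = c) (hY : ∀ b, S.η b (Y b) = d) (b : B) :
    S.η b (mlieBracket (𝓡 m) X Y b) = -(2 * S.metric.inner b (X b) (S.φ b (Y b))) := by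
  rw [← S.contact X Y hXs hYs, S.formDeriv_η hX hY, neg_neg]

theorem η_mlieBracket_ξ {X : ∀ b : B, TangentSpace (𝓡 m) b} {c : ℝ}
    (hXs : IsSmoothField (𝓡 m) X) (hX : ∀ b, S.η b (X b) = c) (b : B) :
    S.η b (mlieBracket (𝓡 m) S.ξ X b) = 0 := by
  rw [S.η_mlieBracket S.smooth_ξ hXs S.η_ξ hX, S.metric.symm, S.inner_ξ, S.η_φ, mul_zero, neg_zero]

/-- The Lie derivative of `φ` along `ξ` vanishes. -/
theorem mlieBracket_ξ_φ {X : ∀ b : B, TangentSpace (𝓡 m) b}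
    (hXs : IsSmoothField (𝓡 m) X) (hX : ∀ b, S.η b (X b) = 0) (b : B) :
    mlieBracket (𝓡 m) S.ξ (S.φField X) b = S.φ b (mlieBracket (𝓡 m) S.ξ X b) := by
  have h := S.normal S.ξ X S.smooth_ξ hXs b
  have h0 : (fun y => S.φ y (S.ξ y)) = 0 := funext S.φ_ξ
  rw [S.formDeriv_η S.η_ξ hX, S.η_mlieBracket_ξ hXs hX, neg_zero, zero_smul, add_zero, nijenhuis,
    h0, mlieBracket_zero_left, mlieBracket_zero_left] at h
  have h1 : S.φ b (S.φ b (mlieBracket (𝓡 m) S.ξ X b)) =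
      S.φ b (mlieBracket (𝓡 m) S.ξ (S.φField X) b) := by
    simpa [sub_eq_zero] using! h
  -- `φ` cannot be cancelled in `φ²[ξ, X] = φ[ξ, φX]` directly. After one more application of `φ`
  -- both sides are `φ²` of a vector in the kernel of `η`, where `φ² = -1`.
  have h2 := congrArg (S.φ b) h1
  rw [S.φ_φ_of_η_eq_zero (S.η_φ b _), S.φ_φ_of_η_eq_zero
    (S.η_mlieBracket_ξ (S.isSmoothField_φField hXs) (fun b => S.η_φ b _) b)] at h2
  exact (neg_injective h2).symm

/-- The two terms are `-2g(φX, φY) = -2g(X, Y)` and `-2g(X, φ²Y) = 2g(X, Y)`. This gives the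
`ξ₃`-component of `N(X*, Y*)`. -/
theorem η_mlieBracket_φ_add {X Y : ∀ b : B, TangentSpace (𝓡 m) b}
    (hXs : IsSmoothField (𝓡 m) X) (hYs : IsSmoothField (𝓡 m) Y)
    (hX : ∀ b, S.η b (X b) = 0) (hY : ∀ b, S.η b (Y b) = 0) (b : B) :
    S.η b (mlieBracket (𝓡 m) (S.φField X) Y b) +
      S.η b (mlieBracket (𝓡 m) X (S.φField Y) b) = 0 := by
  rw [S.η_mlieBracket (S.isSmoothField_φField hXs) hYs (fun b => S.η_φ b _) hY,
    S.η_mlieBracket hXs (S.isSmoothField_φField hYs) hX (fun b => S.η_φ b _)]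
  simp only [φField]
  rw [S.compatible, S.φ_φ_of_η_eq_zero (hY b), hX, map_neg]
  ring

/-- The horizontal part of normality, in terms of fields orthogonal to `ξ`. -/
theorem normal_of_η_eq_zero {X Y : ∀ b : B, TangentSpace (𝓡 m) b}
    (hXs : IsSmoothField (𝓡 m) X) (hYs : IsSmoothField (𝓡 m) Y)
    (hX : ∀ b, S.η b (X b) = 0) (hY : ∀ b, S.η b (Y b) = 0) (b : B) :
    -mlieBracket (𝓡 m) X Y b + mlieBracket (𝓡 m) (S.φField X) (S.φField Y) b -
      S.φ b (mlieBracket (𝓡 m) (S.φField X) Y b) -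
      S.φ b (mlieBracket (𝓡 m) X (S.φField Y) b) = 0 := by
  have h := S.normal X Y hXs hYs b
  -- The term `η([X, Y])ξ` in `φ²[X, Y]` cancels the `dη ⊗ ξ` term of normality.
  rw [S.formDeriv_η hX hY, nijenhuis, S.φ_sq] at h
  rw [← h]
  change _ = -mlieBracket (𝓡 m) X Y b + _ + mlieBracket (𝓡 m) (S.φField X) (S.φField Y) b -
    S.φ b (mlieBracket (𝓡 m) (S.φField X) Y b) - S.φ b (mlieBracket (𝓡 m) X (S.φField Y) b) + _
  module

end SasakianStructure

/-! ### Smooth maps and vertical curves on the induced bundle. -/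

namespace InducedBundle

open Filter Topology

variable {n m : ℕ} {B : Type*} [TopologicalSpace B] [ChartedSpace (EuclideanSpace ℝ (Fin m)) B]
  [IsManifold (𝓡 m) ∞ B] (ι : C^∞⟮𝓡 m, B; 𝓘(ℝ, Fin n → ℍ), HP n⟯)

/-- The index of the local trivialization used for the preferred chart at `p`. -/
def chartIndex (p : InducedBundle ι) : Fin (n + 1) := (exists_apply_ne_zero ι p).choose

theorem mem_triv_source (p : InducedBundle ι) : p ∈ (triv ι (chartIndex ι p)).source :=
  (exists_apply_ne_zero ι p).choose_spec

/-- The preferred chart at `p` is this trivialization followed by a chart of `B × S³`, so the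
trivialization is that chart followed by the inverse of the other. -/
theorem contMDiffAt_triv_chartIndex (p : InducedBundle ι) :
    ContMDiffAt ((𝓡 m).prod (𝓡 3)) ((𝓡 m).prod (𝓡 3)) ∞ (triv ι (chartIndex ι p)) p := by
  let χ := chartAt (ModelProd (EuclideanSpace ℝ (Fin m)) (EuclideanSpace ℝ (Fin 3)))
    (triv ι (chartIndex ι p) p)
  let c := chartAt (ModelProd (EuclideanSpace ℝ (Fin m)) (EuclideanSpace ℝ (Fin 3))) p
  have hc : ContMDiffAt ((𝓡 m).prod (𝓡 3)) ((𝓡 m).prod (𝓡 3)) ∞ c p :=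
    (contMDiffOn_chart (n := ∞)).contMDiffAt (chart_source_mem_nhds _ p)
  have hχ : ContMDiffAt ((𝓡 m).prod (𝓡 3)) ((𝓡 m).prod (𝓡 3)) ∞ χ.symm
      (χ (triv ι (chartIndex ι p) p)) :=
    (contMDiffOn_chart_symm (n := ∞)).contMDiffAt
      (chart_target_mem_nhds _ (triv ι (chartIndex ι p) p))
  refine (hχ.comp p hc).congr_of_eventuallyEq ?_
  filter_upwards [chart_source_mem_nhds
    (ModelProd (EuclideanSpace ℝ (Fin m)) (EuclideanSpace ℝ (Fin 3))) p] with q hq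
  exact (χ.left_inv hq.2).symm

theorem contMDiffAt_triv_symm_chartIndex (p : InducedBundle ι) :
    ContMDiffAt ((𝓡 m).prod (𝓡 3)) ((𝓡 m).prod (𝓡 3)) ∞ (triv ι (chartIndex ι p)).symm
      (triv ι (chartIndex ι p) p) := by
  let χ := chartAt (ModelProd (EuclideanSpace ℝ (Fin m)) (EuclideanSpace ℝ (Fin 3)))
    (triv ι (chartIndex ι p) p)
  let c := chartAt (ModelProd (EuclideanSpace ℝ (Fin m)) (EuclideanSpace ℝ (Fin 3))) p
  have hc : ContMDiffAt ((𝓡 m).prod (𝓡 3)) ((𝓡 m).prod (𝓡 3)) ∞ c.symm (c p) :=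
    (contMDiffOn_chart_symm (n := ∞)).contMDiffAt (chart_target_mem_nhds _ p)
  have hχ : ContMDiffAt ((𝓡 m).prod (𝓡 3)) ((𝓡 m).prod (𝓡 3)) ∞ χ
      (triv ι (chartIndex ι p) p) :=
    (contMDiffOn_chart (n := ∞)).contMDiffAt (chart_source_mem_nhds _ _)
  refine (hc.comp (triv ι (chartIndex ι p) p) hχ).congr_of_eventuallyEq ?_
  filter_upwards [chart_source_mem_nhds
    (ModelProd (EuclideanSpace ℝ (Fin m)) (EuclideanSpace ℝ (Fin 3)))
      (triv ι (chartIndex ι p) p)] with q hq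
  exact congrArg (triv ι (chartIndex ι p)).symm (χ.left_inv hq).symm

/-- An arbitrary trivialization is the preferred one followed by a transition map, which is smooth
by `contMDiffOn_triv`. -/
theorem contMDiffAt_triv_of_mem {i : Fin (n + 1)} {p : InducedBundle ι}
    (hp : p ∈ (triv ι i).source) :
    ContMDiffAt ((𝓡 m).prod (𝓡 3)) ((𝓡 m).prod (𝓡 3)) ∞ (triv ι i) p := by
  let e := triv ι (chartIndex ι p)
  have h1 : ContMDiffAt ((𝓡 m).prod (𝓡 3)) ((𝓡 m).prod (𝓡 3)) ∞ (e.symm ≫ₕ triv ι i) (e p) := by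
    refine (contMDiffOn_triv ι (chartIndex ι p) i).contMDiffAt
      ((e.symm ≫ₕ triv ι i).open_source.mem_nhds ⟨e.map_source (mem_triv_source ι p), ?_⟩)
    rw [Set.mem_preimage]
    erw [e.left_inv (mem_triv_source ι p)]
    exact hp
  refine (h1.comp p (contMDiffAt_triv_chartIndex ι p)).congr_of_eventuallyEq ?_
  filter_upwards [e.open_source.mem_nhds (mem_triv_source ι p)] with q hq
  exact congrArg (triv ι i) (e.left_inv hq).symm

theorem contMDiffAt_triv_symm_of_mem {i : Fin (n + 1)} {p : InducedBundle ι}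
    (hp : p ∈ (triv ι i).source) :
    ContMDiffAt ((𝓡 m).prod (𝓡 3)) ((𝓡 m).prod (𝓡 3)) ∞ (triv ι i).symm (triv ι i p) := by
  let e := triv ι (chartIndex ι p)
  let s := ((triv ι i).symm ≫ₕ e).source
  have hmem : triv ι i p ∈ s := by
    refine ⟨(triv ι i).map_source hp, ?_⟩
    rw [Set.mem_preimage]
    erw [(triv ι i).left_inv hp]
    exact mem_triv_source ι p
  have hs : s ∈ 𝓝 (triv ι i p) := ((triv ι i).symm ≫ₕ e).open_source.mem_nhds hmem
  have h1 : ContMDiffAt ((𝓡 m).prod (𝓡 3)) ((𝓡 m).prod (𝓡 3)) ∞ ((triv ι i).symm ≫ₕ e)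
      (triv ι i p) := (contMDiffOn_triv ι i (chartIndex ι p)).contMDiffAt hs
  have h2 : ContMDiffAt ((𝓡 m).prod (𝓡 3)) ((𝓡 m).prod (𝓡 3)) ∞ e.symm
      (((triv ι i).symm ≫ₕ e) (triv ι i p)) := by
    have : ((triv ι i).symm ≫ₕ e) (triv ι i p) = e p := congrArg e ((triv ι i).left_inv hp)
    rw [this]
    exact contMDiffAt_triv_symm_chartIndex ι p
  refine (h2.comp _ h1).congr_of_eventuallyEq ?_
  filter_upwards [hs] with q hq
  exact (e.left_inv hq.2).symm

theorem contMDiff_proj : ContMDiff ((𝓡 m).prod (𝓡 3)) (𝓡 m) ∞ (proj ι) := fun p =>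
  (contMDiff_fst (I := 𝓡 m) (J := 𝓡 3) (M := B) (N := S3)).contMDiffAt.comp p
    (contMDiffAt_triv_of_mem ι (mem_triv_source ι p))

/-- The map to `ℍⁿ⁺¹` in the `i`-th local trivialization. -/
def toVecTriv (i : Fin (n + 1)) (x : B × S3) : HVec n :=
  (x.2 : ℍ) • (‖HP.affineVec i (HP.affineCoord i (ι x.1))‖⁻¹ •
    HP.affineVec i (HP.affineCoord i (ι x.1)))

/-- The section `hopfSec` is defined through a chosen representative of each line, so its smoothness
is not visible. On this domain it equals the normalized affine vector, which depends smoothly on the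
line. -/
theorem toVec_eq {i : Fin (n + 1)} {p : InducedBundle ι} (hp : p ∈ (triv ι i).source) :
    toVec ι p = toVecTriv ι i (triv ι i p) := by
  have h1 := sphereSMul_hopfSec p.1.2 hp
  have h2 : HP.rep (ι p.1.1) i ≠ 0 := by
    rw [← p.2]
    exact (rep_hopf_ne_zero_iff i _).2 hp
  have h3 : (p.1.2 : HVec n) = (dir ((p.1.2 : HVec n) i) : ℍ) • (hopfSec i (ι p.1.1) : HVec n) := by
    rw [← p.2]
    exact congrArg Subtype.val h1.symm
  rw [coe_hopfSec h2] at h3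
  exact h3

theorem contMDiffAt_toVecTriv {i : Fin (n + 1)} {x : B × S3} (hx : x ∈ (triv ι i).target) :
    ContMDiffAt ((𝓡 m).prod (𝓡 3)) 𝓘(ℝ, HVec n) ∞ (toVecTriv ι i) x := by
  have hw : ContMDiffOn ((𝓡 m).prod (𝓡 3)) 𝓘(ℝ, Fin n → ℍ) ∞
      (fun x : B × S3 => HP.affineCoord i (ι x.1)) (triv ι i).target :=
    (contMDiffOn_of_mem_maximalAtlas (IsManifold.subset_maximalAtlas (n := ∞)
      (I := 𝓘(ℝ, Fin n → ℍ)) (Set.mem_range_self i) :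
        HP.affineChart i ∈ IsManifold.maximalAtlas 𝓘(ℝ, Fin n → ℍ) ∞ (HP n))).comp
      (ι.contMDiff.comp contMDiff_fst).contMDiffOn fun x hx => hx
  have hu : ContMDiff ((𝓡 m).prod (𝓡 3)) 𝓘(ℝ, ℍ) ∞ (fun x : B × S3 => (x.2 : ℍ)) :=
    contMDiff_coe_sphere.comp contMDiff_snd
  have hF : ContDiff ℝ ∞ (fun y : (Fin n → ℍ) × ℍ =>
      y.2 • (‖HP.affineVec i y.1‖⁻¹ • HP.affineVec i y.1)) := by
    have h1 : ContDiff ℝ ∞ (fun y : (Fin n → ℍ) × ℍ => HP.affineVec i y.1) :=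
      (HP.contDiff_affineVec i).comp contDiff_fst
    exact contDiff_snd.smul (((h1.norm ℝ fun y => HP.affineVec_ne_zero _ _).inv
      fun y => norm_ne_zero_iff.2 (HP.affineVec_ne_zero _ _)).smul h1)
  exact hF.contMDiff.contMDiffAt.comp x
    ((hw.contMDiffAt ((triv ι i).open_target.mem_nhds hx)).prodMk_space hu.contMDiffAt)

theorem contMDiff_toVec : ContMDiff ((𝓡 m).prod (𝓡 3)) 𝓘(ℝ, HVec n) ∞ (toVec ι) := by
  intro p
  have hp := mem_triv_source ι p
  refine ((contMDiffAt_toVecTriv ι ((triv ι _).map_source hp)).comp p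
    (contMDiffAt_triv_of_mem ι hp)).congr_of_eventuallyEq ?_
  filter_upwards [(triv ι (chartIndex ι p)).open_source.mem_nhds hp] with q hq
  exact toVec_eq ι hq

theorem mdifferentiableAt_proj (p : InducedBundle ι) :
    MDifferentiableAt ((𝓡 m).prod (𝓡 3)) (𝓡 m) (proj ι) p :=
  (contMDiff_proj ι p).mdifferentiableAt (by simp)

theorem mdifferentiableAt_toVec (p : InducedBundle ι) :
    MDifferentiableAt ((𝓡 m).prod (𝓡 3)) 𝓘(ℝ, HVec n) (toVec ι) p :=
  (contMDiff_toVec ι p).mdifferentiableAt (by simp)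

/-- The differential of the map to `ℍⁿ⁺¹`. -/
def dvec (p : InducedBundle ι) : TangentSpace ((𝓡 m).prod (𝓡 3)) p →L[ℝ] HVec n :=
  mvfderiv ((𝓡 m).prod (𝓡 3)) (toVec ι) p

theorem dproj_surjective (p : InducedBundle ι) : Function.Surjective (dproj ι p) := by
  let e := triv ι (chartIndex ι p)
  have hp := mem_triv_source ι p
  -- A section through `p` with constant `S³`-component; near `π(p)` it is smooth, and its
  -- differential is a right inverse of `dπ`.
  let s : B → InducedBundle ι := fun b => e.symm (b, (e p).2)
  have hsp : s (proj ι p) = p := e.left_inv hp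
  have hj : ContMDiffAt (𝓡 m) ((𝓡 m).prod (𝓡 3)) ∞ (fun b : B => (b, (e p).2)) (proj ι p) :=
    contMDiffAt_id.prodMk contMDiffAt_const
  have hs : ContMDiffAt (𝓡 m) ((𝓡 m).prod (𝓡 3)) ∞ s (proj ι p) :=
    (contMDiffAt_triv_symm_of_mem ι hp).comp (proj ι p) hj
  have hid : (fun b => proj ι (s b)) = id := rfl
  intro w
  have h1 : mfderiv (𝓡 m) (𝓡 m) (fun b => proj ι (s b)) (proj ι p) w = w := by
    rw [hid, mfderiv_id]
    rfl
  have h2 := mfderiv_comp_apply (proj ι p) (mdifferentiableAt_proj ι (s (proj ι p)))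
    (hs.mdifferentiableAt (by simp)) w
  refine ⟨mfderiv (𝓡 m) ((𝓡 m).prod (𝓡 3)) s (proj ι p) w, ?_⟩
  -- The equality `s (proj ι p) = p` is not definitional, so the tangent spaces at these points have
  -- different types and the vectors are compared in the model space.
  have h3 : ∀ q, q = p → ∀ v : EuclideanSpace ℝ (Fin m) × EuclideanSpace ℝ (Fin 3),
      (mfderiv ((𝓡 m).prod (𝓡 3)) (𝓡 m) (proj ι) q v : EuclideanSpace ℝ (Fin m)) =
        mfderiv ((𝓡 m).prod (𝓡 3)) (𝓡 m) (proj ι) p v := by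
    rintro q rfl v
    rfl
  exact (h3 _ hsp _).symm.trans (h2.symm.trans h1)

theorem mfderiv_apply_mfderiv_curve {F : Type*} [NormedAddCommGroup F] [NormedSpace ℝ F]
    {G : Type*} [TopologicalSpace G] {J : ModelWithCorners ℝ F G} {N : Type*} [TopologicalSpace N]
    [ChartedSpace G N] {f : InducedBundle ι → N} {γ : ℝ → InducedBundle ι} {p : InducedBundle ι}
    (hγ : MDifferentiableAt 𝓘(ℝ, ℝ) ((𝓡 m).prod (𝓡 3)) γ 0) (h0 : γ 0 = p)
    (hf : MDifferentiableAt ((𝓡 m).prod (𝓡 3)) J f p) :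
    (mfderiv ((𝓡 m).prod (𝓡 3)) J f p
      (mfderiv 𝓘(ℝ, ℝ) ((𝓡 m).prod (𝓡 3)) γ 0 (1 : ℝ) :
        EuclideanSpace ℝ (Fin m) × EuclideanSpace ℝ (Fin 3)) : F) =
      mfderiv 𝓘(ℝ, ℝ) J (fun t => f (γ t)) 0 (1 : ℝ) := by
  subst h0
  exact (mfderiv_comp_apply (0 : ℝ) hf hγ 1).symm

theorem contMDiff_oneParam (a : Fin 3) : ContMDiff 𝓘(ℝ, ℝ) (𝓡 3) ∞ (oneParam a) := by
  rw [← contMDiffOn_univ]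
  refine contMDiffOn_sphere_iff ?_
  have h : ContDiff ℝ ∞ (fun t : ℝ => NormedSpace.exp (-(t • imagUnit a))) :=
    (contDiff_iff_contDiffAt.2 fun x =>
      (NormedSpace.exp_analytic (𝕂 := ℝ) x).contDiffAt).comp (by fun_prop)
  exact h.contMDiff.contMDiffOn

theorem oneParam_zero (a : Fin 3) : oneParam a 0 = 1 := by
  ext1
  simp [oneParam]

theorem act_one (p : InducedBundle ι) : act ι 1 p = p := by
  refine Subtype.ext (Prod.ext rfl (Subtype.ext ?_))
  exact one_smul ℍ _

theorem mdifferentiableAt_act_oneParam (a : Fin 3) (p : InducedBundle ι) :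
    MDifferentiableAt 𝓘(ℝ, ℝ) ((𝓡 m).prod (𝓡 3)) (fun t => act ι (oneParam a t) p) 0 := by
  let e := triv ι (chartIndex ι p)
  have hp := mem_triv_source ι p
  -- In a trivialization the action is left multiplication on the factor `S³`.
  have hγ : (fun t => act ι (oneParam a t) p) = fun t => e.symm (p.1.1, oneParam a t * (e p).2) := by
    funext t
    have h1 : (act ι (oneParam a t) p) ∈ e.source := by
      change (oneParam a t : ℍ) * (p.1.2 : HVec n) (chartIndex ι p) ≠ 0
      exact mul_ne_zero (ne_zero_of_mem_unit_sphere _) hp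
    have h2 : e (act ι (oneParam a t) p) = (p.1.1, oneParam a t * (e p).2) :=
      Prod.ext rfl (dir_smul (oneParam a t) hp)
    rw [← h2, e.left_inv h1]
  have h0 : ((p.1.1, oneParam a 0 * (e p).2) : B × S3) = e p := by
    rw [oneParam_zero, one_mul]
    rfl
  have hm : ContMDiff 𝓘(ℝ, ℝ) (𝓡 3) ∞ (fun t => oneParam a t * (e p).2) := by
    rw [← contMDiffOn_univ]
    refine contMDiffOn_sphere_iff ?_
    have h1 : ContMDiff 𝓘(ℝ, ℝ) 𝓘(ℝ, ℍ) ∞ (fun t => (oneParam a t : ℍ)) :=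
      contMDiff_coe_sphere.comp (contMDiff_oneParam a)
    have h2 : ContDiff ℝ ∞ (fun q : ℍ => q * ((e p).2 : ℍ)) := contDiff_id.mul contDiff_const
    exact (h2.contMDiff.comp h1).contMDiffOn
  have hs : ContMDiffAt ((𝓡 m).prod (𝓡 3)) ((𝓡 m).prod (𝓡 3)) ∞ e.symm
      (p.1.1, oneParam a 0 * (e p).2) := by
    rw [h0]
    exact contMDiffAt_triv_symm_of_mem ι hp
  rw [hγ]
  exact (ContMDiffAt.comp (0 : ℝ) hs (contMDiffAt_const.prodMk hm.contMDiffAt)).mdifferentiableAt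
    (by simp)

theorem act_oneParam_zero (a : Fin 3) (p : InducedBundle ι) : act ι (oneParam a 0) p = p := by
  rw [oneParam_zero, act_one]

theorem dproj_vert (a : Fin 3) (p : InducedBundle ι) : dproj ι p (vert ι a p) = 0 := by
  refine (mfderiv_apply_mfderiv_curve ι (mdifferentiableAt_act_oneParam ι a p)
    (act_oneParam_zero ι a p) (mdifferentiableAt_proj ι p)).trans ?_
  have : (fun t => proj ι (act ι (oneParam a t) p)) = fun _ => proj ι p := rfl
  rw [this, mfderiv_const]
  rfl

theorem dvec_vert (a : Fin 3) (p : InducedBundle ι) :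
    dvec ι p (vert ι a p) = -(imagUnit a • toVec ι p) := by
  refine (mfderiv_apply_mfderiv_curve ι (mdifferentiableAt_act_oneParam ι a p)
    (act_oneParam_zero ι a p) (mdifferentiableAt_toVec ι p)).trans ?_
  have h1 : HasDerivAt (fun t : ℝ => NormedSpace.exp (t • -imagUnit a)) (-imagUnit a) 0 := by
    have := hasDerivAt_exp_smul_const (𝕂 := ℝ) (-imagUnit a) (0 : ℝ)
    simpa using this
  have h2 : HasDerivAt (fun t : ℝ => NormedSpace.exp (t • -imagUnit a) • toVec ι p)
      (-imagUnit a • toVec ι p) 0 := h1.smul_const _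
  have h3 : (fun t => toVec ι (act ι (oneParam a t) p)) =
      fun t : ℝ => NormedSpace.exp (t • -imagUnit a) • toVec ι p := by
    funext t
    rw [smul_neg]
    rfl
  rw [h3, mfderiv_eq_fderiv, ← neg_smul]
  exact (congrArg (fun L : ℝ →L[ℝ] HVec n => L 1) h2.hasFDerivAt.fderiv).trans (one_smul ℝ _)

end InducedBundle

/-! ### Imaginary quaternions and the quaternionic Hermitian form. -/

theorem re_imagUnit (a : Fin 3) : (imagUnit a).re = 0 := by fin_cases a <;> rfl

theorem imI_imagUnit (a : Fin 3) : (imagUnit a).imI = if a = 0 then 1 else 0 := by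
  fin_cases a <;> rfl

theorem imJ_imagUnit (a : Fin 3) : (imagUnit a).imJ = if a = 1 then 1 else 0 := by
  fin_cases a <;> rfl

theorem imK_imagUnit (a : Fin 3) : (imagUnit a).imK = if a = 2 then 1 else 0 := by
  fin_cases a <;> rfl

theorem quaternion_inner_eq (p q : ℍ) :
    inner ℝ p q = p.re * q.re + p.imI * q.imI + p.imJ * q.imJ + p.imK * q.imK := by
  simp [Quaternion.inner_def, Quaternion.re_mul]

theorem inner_imagUnit (a b : Fin 3) :
    inner ℝ (imagUnit a) (imagUnit b) = if a = b then (1 : ℝ) else 0 := by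
  rw [quaternion_inner_eq, re_imagUnit, imI_imagUnit, imJ_imagUnit, imK_imagUnit, re_imagUnit,
    imI_imagUnit, imJ_imagUnit, imK_imagUnit]
  fin_cases a <;> fin_cases b <;> simp

theorem eq_sum_imagUnit {q : ℍ} (hq : q.re = 0) :
    q = ∑ a : Fin 3, (inner ℝ (imagUnit a) q : ℝ) • imagUnit a := by
  rw [Fin.sum_univ_three]
  ext <;> simp [quaternion_inner_eq, re_imagUnit, imI_imagUnit, imJ_imagUnit, imK_imagUnit, hq]

/-- Quaternionic conjugation. -/
def conjL : ℍ →L[ℝ] ℍ :=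
  LinearMap.toContinuousLinearMap
    { toFun := star
      map_add' := star_add
      map_smul' := fun r q => Quaternion.star_smul r q }

/-- The pairing `(u, v) ↦ ∑ⱼ uⱼ v̄ⱼ` of `ℍⁿ⁺¹`. -/
def herm (n : ℕ) : HVec n →L[ℝ] HVec n →L[ℝ] ℍ :=
  ∑ j : Fin (n + 1), (ContinuousLinearMap.mul ℝ ℍ).bilinearComp
    (PiLp.proj 2 (fun _ : Fin (n + 1) => ℍ) j : HVec n →L[ℝ] ℍ)
    (conjL.comp (PiLp.proj 2 (fun _ : Fin (n + 1) => ℍ) j : HVec n →L[ℝ] ℍ))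

theorem herm_apply {n : ℕ} (u v : HVec n) : herm n u v = ∑ j, u j * star (v j) := by
  simp only [herm, sum_apply]
  rfl

theorem herm_smul_left {n : ℕ} (q : ℍ) (u v : HVec n) : herm n (q • u) v = q * herm n u v := by
  rw [herm_apply, herm_apply, Finset.mul_sum]
  exact Finset.sum_congr rfl fun j _ => mul_assoc _ _ _

theorem herm_smul_right {n : ℕ} (q : ℍ) (u v : HVec n) :
    herm n u (q • v) = herm n u v * star q := by
  rw [herm_apply, herm_apply, Finset.sum_mul]
  refine Finset.sum_congr rfl fun j _ => ?_
  rw [PiLp.smul_apply, smul_eq_mul, star_mul, mul_assoc]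

theorem star_herm {n : ℕ} (u v : HVec n) : star (herm n u v) = herm n v u := by
  rw [herm_apply, herm_apply, star_sum]
  refine Finset.sum_congr rfl fun j _ => ?_
  rw [star_mul, star_star]

theorem herm_neg_left {n : ℕ} (u v : HVec n) : herm n (-u) v = -herm n u v := by
  rw [herm_apply, herm_apply, ← Finset.sum_neg_distrib]
  exact Finset.sum_congr rfl fun j _ => neg_mul _ _

theorem herm_neg_right {n : ℕ} (u v : HVec n) : herm n u (-v) = -herm n u v := by
  rw [← star_herm, herm_neg_left, star_neg, star_herm]

theorem herm_self {n : ℕ} (u : HVec n) : herm n u u = ((‖u‖ ^ 2 : ℝ) : ℍ) := by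
  rw [herm_apply, PiLp.norm_sq_eq_of_L2]
  have : ((∑ j, ‖u j‖ ^ 2 : ℝ) : ℍ) = ∑ j, ((‖u j‖ ^ 2 : ℝ) : ℍ) :=
    map_sum (⟨⟨fun r : ℝ => (r : ℍ), Quaternion.coe_zero⟩, Quaternion.coe_add⟩ : ℝ →+ ℍ) _ _
  rw [this]
  refine Finset.sum_congr rfl fun j _ => ?_
  rw [Quaternion.self_mul_star, Quaternion.normSq_eq_norm_mul_self, pow_two]

/-! ### The connection, the frame `(dπ, η̂)` and horizontal lifts. -/

namespace InducedBundle

open Filter Topology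

variable {n m : ℕ} {B : Type*} [TopologicalSpace B] [ChartedSpace (EuclideanSpace ℝ (Fin m)) B]
  [IsManifold (𝓡 m) ∞ B] (ι : C^∞⟮𝓡 m, B; 𝓘(ℝ, Fin n → ℍ), HP n⟯)

theorem herm_toVec_self (p : InducedBundle ι) : herm n (toVec ι p) (toVec ι p) = 1 := by
  have : ‖toVec ι p‖ = 1 := norm_eq_of_mem_sphere p.1.2
  rw [herm_self, this]
  simp

theorem connForm_apply (p : InducedBundle ι) (v : TangentSpace ((𝓡 m).prod (𝓡 3)) p) :
    connForm ι p v = herm n (dvec ι p v) (toVec ι p) := by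
  rw [herm_apply]
  simp only [connForm, ContinuousLinearMap.comp_apply, sum_apply]
  rfl

/-- Differentiating `⟨h, h⟩ = 1` gives `ω + ω̄ = 0`. So `ω` is determined by the three forms `η̂ₐ`.
-/
theorem re_connForm (p : InducedBundle ι) (v : TangentSpace ((𝓡 m).prod (𝓡 3)) p) :
    (connForm ι p v).re = 0 := by
  have h1 := mvfderiv_bilinear (herm n) (mdifferentiableAt_toVec ι p)
    (mdifferentiableAt_toVec ι p) v
  have h2 : (fun q => herm n (toVec ι q) (toVec ι q)) = fun _ => 1 :=
    funext (herm_toVec_self ι)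
  rw [h2, mvfderiv_const] at h1
  have h3 : (0 : ℍ) = herm n (dvec ι p v) (toVec ι p) + herm n (toVec ι p) (dvec ι p v) := h1
  rw [← star_herm (dvec ι p v), ← connForm_apply] at h3
  have h4 := congrArg QuaternionAlgebra.re h3
  simp at h4
  linarith

theorem connForm_eq (p : InducedBundle ι) (v : TangentSpace ((𝓡 m).prod (𝓡 3)) p) :
    connForm ι p v = -∑ a, etaHat ι a p v • imagUnit a := by
  conv_lhs => rw [eq_sum_imagUnit (re_connForm ι p v)]
  rw [← Finset.sum_neg_distrib]
  refine Finset.sum_congr rfl fun a _ => ?_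
  rw [← neg_smul, etaHat]
  simp

theorem connForm_vert (a : Fin 3) (p : InducedBundle ι) :
    connForm ι p (vert ι a p) = -imagUnit a := by
  rw [connForm_apply, dvec_vert, herm_neg_left, herm_smul_left,
    herm_toVec_self, mul_one]

theorem etaHat_apply (a : Fin 3) (p : InducedBundle ι) (v : TangentSpace ((𝓡 m).prod (𝓡 3)) p) :
    etaHat ι a p v = -inner ℝ (imagUnit a) (connForm ι p v) := rfl

theorem etaHat_vert (a b : Fin 3) (p : InducedBundle ι) :
    etaHat ι a p (vert ι b p) = if a = b then 1 else 0 := by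
  rw [etaHat_apply, connForm_vert, inner_neg_right, neg_neg, inner_imagUnit]

/-- The map `(dπ, η̂) : T_p P → T_{π(p)} B × ℝ³`. -/
def frameMap (p : InducedBundle ι) : TangentSpace ((𝓡 m).prod (𝓡 3)) p →L[ℝ]
    TangentSpace (𝓡 m) (proj ι p) × (Fin 3 → ℝ) :=
  (dproj ι p).prod (ContinuousLinearMap.pi fun a => etaHat ι a p)

theorem frameMap_surjective (p : InducedBundle ι) : Function.Surjective (frameMap ι p) := by
  rintro ⟨w, c⟩
  obtain ⟨v, rfl⟩ := dproj_surjective ι p w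
  -- Any lift of `w` is corrected by vertical vectors, on which `η̂` is dual to `ξ₁, ξ₂, ξ₃` and
  -- `dπ` vanishes.
  refine ⟨v + ∑ b, (c b - etaHat ι b p v) • vert ι b p, Prod.ext ?_ (funext fun a => ?_)⟩
  · change dproj ι p _ = _
    simp [map_sum, dproj_vert]
  · change etaHat ι a p _ = c a
    simp [map_sum, etaHat_vert]

/-- Both spaces have dimension `m + 3`, so surjectivity suffices. -/
theorem isInvertible_frameMap (p : InducedBundle ι) : (frameMap ι p).IsInvertible := by
  let Φ : EuclideanSpace ℝ (Fin m) × EuclideanSpace ℝ (Fin 3) →L[ℝ]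
    EuclideanSpace ℝ (Fin m) × (Fin 3 → ℝ) := frameMap ι p
  have hs : Function.Surjective Φ.toLinearMap := frameMap_surjective ι p
  have hi : Function.Injective Φ.toLinearMap :=
    (LinearMap.injective_iff_surjective_of_finrank_eq_finrank (by simp)).2 hs
  exact ⟨(LinearEquiv.ofBijective Φ.toLinearMap ⟨hi, hs⟩).toContinuousLinearEquiv, by ext1; rfl⟩

theorem frameMap_injective (p : InducedBundle ι) : Function.Injective (frameMap ι p) :=
  (isInvertible_frameMap ι p).injective

/-- Identities between tangent vectors of the bundle, the vanishing of the Nijenhuis tensor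
included, are checked through these components. -/
theorem tangent_ext {p : InducedBundle ι} {v w : TangentSpace ((𝓡 m).prod (𝓡 3)) p}
    (h : dproj ι p v = dproj ι p w) (h' : ∀ a, etaHat ι a p v = etaHat ι a p w) : v = w :=
  frameMap_injective ι p (Prod.ext h (funext h'))

/-- `ContinuousLinearMap.inverse` is zero on non-invertible maps; invertibility of the frame map is
what makes `hlift` a genuine horizontal lift. -/
theorem frameMap_hlift (p : InducedBundle ι) (w : TangentSpace (𝓡 m) (proj ι p)) :
    frameMap ι p (hlift ι p w) = (w, 0) :=
  (isInvertible_frameMap ι p).self_apply_inverse _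

theorem dproj_hlift (p : InducedBundle ι) (w : TangentSpace (𝓡 m) (proj ι p)) :
    dproj ι p (hlift ι p w) = w :=
  congrArg Prod.fst (frameMap_hlift ι p w)

theorem etaHat_hlift (a : Fin 3) (p : InducedBundle ι) (w : TangentSpace (𝓡 m) (proj ι p)) :
    etaHat ι a p (hlift ι p w) = 0 :=
  congrFun (congrArg Prod.snd (frameMap_hlift ι p w)) a

theorem connForm_hlift (p : InducedBundle ι) (w : TangentSpace (𝓡 m) (proj ι p)) :
    connForm ι p (hlift ι p w) = 0 := by
  simp [connForm_eq, etaHat_hlift]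

theorem dproj_liftField (X : ∀ b : B, TangentSpace (𝓡 m) b) (p : InducedBundle ι) :
    dproj ι p (liftField ι X p) = X (proj ι p) :=
  dproj_hlift ι p _

theorem horPart_liftField (X : ∀ b : B, TangentSpace (𝓡 m) b) :
    horPart ι (liftField ι X) = liftField ι X := by
  funext p
  rw [horPart, dproj_liftField, liftField]

theorem contMDiffAt_etaHat {A : ∀ p : InducedBundle ι, TangentSpace ((𝓡 m).prod (𝓡 3)) p}
    {p : InducedBundle ι} (hA : IsSmoothFieldAt ((𝓡 m).prod (𝓡 3)) A p) (a : Fin 3) :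
    ContMDiffAt ((𝓡 m).prod (𝓡 3)) 𝓘(ℝ, ℝ) ∞ (fun q => etaHat ι a q (A q)) p := by
  have h1 : ContMDiffAt ((𝓡 m).prod (𝓡 3)) 𝓘(ℝ, HVec n) ∞ (fun q => dvec ι q (A q)) p :=
    contMDiffAt_mvfderiv_apply (contMDiff_toVec ι p) hA
  have h2 : ContDiff ℝ ∞ (fun y : HVec n × HVec n =>
      -inner ℝ (imagUnit a) (herm n y.1 y.2)) := by
    have : ContDiff ℝ ∞ (fun y : HVec n × HVec n => herm n y.1 y.2) :=
      (herm n).isBoundedBilinearMap.contDiff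
    exact (contDiff_const.inner ℝ this).neg
  have h3 := h2.contMDiff.contMDiffAt.comp p (h1.prodMk_space (contMDiff_toVec ι p))
  refine h3.congr_of_eventuallyEq (Eventually.of_forall fun q => ?_)
  exact (etaHat_apply ι a q (A q)).trans
    (congrArg (fun z : ℍ => -inner ℝ (imagUnit a) z) (connForm_apply ι q (A q)))

theorem contMDiffAt_dproj {A : ∀ p : InducedBundle ι, TangentSpace ((𝓡 m).prod (𝓡 3)) p}
    {p : InducedBundle ι} (hA : IsSmoothFieldAt ((𝓡 m).prod (𝓡 3)) A p) :
    ContMDiffAt ((𝓡 m).prod (𝓡 3)) (𝓡 m).tangent ∞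
      (fun q => (⟨proj ι q, dproj ι q (A q)⟩ : TangentBundle (𝓡 m) B)) p :=
  contMDiffAt_mfderiv_apply (contMDiff_proj ι p) hA

/-- The map `(dπ, η̂)` in trivializations of the tangent bundles around `p` and `π(p)`. -/
def frameMapTriv (p q : InducedBundle ι) : EuclideanSpace ℝ (Fin m) × EuclideanSpace ℝ (Fin 3) →L[ℝ]
    EuclideanSpace ℝ (Fin m) × (Fin 3 → ℝ) :=
  (((trivializationAt (EuclideanSpace ℝ (Fin m)) (TangentSpace (𝓡 m)) (proj ι p)).continuousLinearMapAt
    ℝ (proj ι q)).comp ((dproj ι q).comp ((trivializationAt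
      (EuclideanSpace ℝ (Fin m) × EuclideanSpace ℝ (Fin 3))
      (TangentSpace ((𝓡 m).prod (𝓡 3))) p).symmL ℝ q))).prod
  ((ContinuousLinearMap.pi fun a => etaHat ι a q).comp ((trivializationAt
      (EuclideanSpace ℝ (Fin m) × EuclideanSpace ℝ (Fin 3))
      (TangentSpace ((𝓡 m).prod (𝓡 3))) p).symmL ℝ q))

/-- Near `p` this is the injective map `(dπ, η̂)` conjugated by trivializations, between spaces of
equal dimension. -/
theorem isInvertible_frameMapTriv {p q : InducedBundle ι}
    (hq : q ∈ (trivializationAt (EuclideanSpace ℝ (Fin m) × EuclideanSpace ℝ (Fin 3))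
      (TangentSpace ((𝓡 m).prod (𝓡 3))) p).baseSet)
    (hq' : proj ι q ∈ (trivializationAt (EuclideanSpace ℝ (Fin m))
      (TangentSpace (𝓡 m)) (proj ι p)).baseSet) : (frameMapTriv ι p q).IsInvertible := by
  have hi : Function.Injective (frameMapTriv ι p q) := by
    intro v w h
    have h1 := congrArg Prod.fst h
    have h2 := congrArg Prod.snd h
    apply (Function.LeftInverse.injective fun v =>
      (trivializationAt (EuclideanSpace ℝ (Fin m) × EuclideanSpace ℝ (Fin 3))
        (TangentSpace ((𝓡 m).prod (𝓡 3))) p).continuousLinearMapAt_symmL (R := ℝ) hq v)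
    refine tangent_ext ι ?_ fun a => congrFun h2 a
    apply (Function.LeftInverse.injective fun v =>
      (trivializationAt (EuclideanSpace ℝ (Fin m))
        (TangentSpace (𝓡 m)) (proj ι p)).symmL_continuousLinearMapAt (R := ℝ) hq' v)
    exact h1
  have hs : Function.Surjective (frameMapTriv ι p q).toLinearMap :=
    (LinearMap.injective_iff_surjective_of_finrank_eq_finrank (by simp)).1 hi
  exact ⟨(LinearEquiv.ofBijective (frameMapTriv ι p q).toLinearMap
    ⟨hi, hs⟩).toContinuousLinearEquiv, ContinuousLinearMap.ext fun _ => rfl⟩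

theorem contMDiffAt_triv_dproj {A : ∀ p : InducedBundle ι, TangentSpace ((𝓡 m).prod (𝓡 3)) p}
    {p : InducedBundle ι}
    (h : ContMDiffAt ((𝓡 m).prod (𝓡 3)) (𝓡 m).tangent ∞
      (fun q => (⟨proj ι q, dproj ι q (A q)⟩ : TangentBundle (𝓡 m) B)) p) :
    ContMDiffAt ((𝓡 m).prod (𝓡 3)) 𝓘(ℝ, EuclideanSpace ℝ (Fin m)) ∞
      (fun q => (trivializationAt (EuclideanSpace ℝ (Fin m))
        (TangentSpace (𝓡 m)) (proj ι p)).continuousLinearMapAt ℝ (proj ι q) (dproj ι q (A q))) p := by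
  have h1 := (contMDiffAt_totalSpace.1 h).2
  refine h1.congr_of_eventuallyEq ?_
  have hev : ∀ᶠ q in 𝓝 p, proj ι q ∈ (trivializationAt (EuclideanSpace ℝ (Fin m))
      (TangentSpace (𝓡 m)) (proj ι p)).baseSet :=
    (contMDiff_proj ι).continuous.continuousAt.eventually
      ((trivializationAt (EuclideanSpace ℝ (Fin m))
      (TangentSpace (𝓡 m)) (proj ι p)).open_baseSet.mem_nhds
        (FiberBundle.mem_baseSet_trivializationAt' _))
  filter_upwards [hev] with q hq
  rw [Trivialization.continuousLinearMapAt_apply, Trivialization.coe_linearMapAt_of_mem _ hq]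

theorem contMDiffAt_frameMapTriv (p : InducedBundle ι) :
    ContMDiffAt ((𝓡 m).prod (𝓡 3)) 𝓘(ℝ, EuclideanSpace ℝ (Fin m) × EuclideanSpace ℝ (Fin 3) →L[ℝ]
      EuclideanSpace ℝ (Fin m) × (Fin 3 → ℝ)) ∞ (frameMapTriv ι p) p := by
  refine contMDiffAt_clm_of_apply fun v => ?_
  have hv := isSmoothFieldAt_coordField (I := (𝓡 m).prod (𝓡 3)) p v
  have h1 := contMDiffAt_triv_dproj ι (contMDiffAt_dproj ι hv)
  have h2 : ContMDiffAt ((𝓡 m).prod (𝓡 3)) 𝓘(ℝ, Fin 3 → ℝ) ∞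
      (fun q a => etaHat ι a q (coordField ((𝓡 m).prod (𝓡 3)) p v q)) p :=
    contMDiffAt_pi_space.2 fun a => contMDiffAt_etaHat ι hv a
  refine (h1.prodMk_space h2).congr_of_eventuallyEq ?_
  filter_upwards [(trivializationAt (EuclideanSpace ℝ (Fin m) × EuclideanSpace ℝ (Fin 3))
      (TangentSpace ((𝓡 m).prod (𝓡 3))) p).open_baseSet.mem_nhds
        (FiberBundle.mem_baseSet_trivializationAt' _)] with q hq
  have h3 : coordField ((𝓡 m).prod (𝓡 3)) p v q =
      (trivializationAt (EuclideanSpace ℝ (Fin m) × EuclideanSpace ℝ (Fin 3))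
      (TangentSpace ((𝓡 m).prod (𝓡 3))) p).symmL ℝ q v :=
    (Trivialization.symmL_apply (R := ℝ) _ hq v).symm
  rw [h3]
  rfl

/-- A vector field `A` on the induced bundle is smooth if `dπ(A)` and `η̂(A)` are. -/
theorem isSmoothFieldAt_of_dproj_etaHat
    {A : ∀ p : InducedBundle ι, TangentSpace ((𝓡 m).prod (𝓡 3)) p} {p : InducedBundle ι}
    (h1 : ContMDiffAt ((𝓡 m).prod (𝓡 3)) (𝓡 m).tangent ∞
      (fun q => (⟨proj ι q, dproj ι q (A q)⟩ : TangentBundle (𝓡 m) B)) p)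
    (h2 : ∀ a, ContMDiffAt ((𝓡 m).prod (𝓡 3)) 𝓘(ℝ, ℝ) ∞ (fun q => etaHat ι a q (A q)) p) :
    IsSmoothFieldAt ((𝓡 m).prod (𝓡 3)) A p := by
  let e := trivializationAt (EuclideanSpace ℝ (Fin m) × EuclideanSpace ℝ (Fin 3))
      (TangentSpace ((𝓡 m).prod (𝓡 3))) p
  let e' := trivializationAt (EuclideanSpace ℝ (Fin m)) (TangentSpace (𝓡 m)) (proj ι p)
  have hp : p ∈ e.baseSet := FiberBundle.mem_baseSet_trivializationAt' _
  have hp' : proj ι p ∈ e'.baseSet := FiberBundle.mem_baseSet_trivializationAt' _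
  have h3 := contMDiffAt_triv_dproj ι h1
  have h4 : ContMDiffAt ((𝓡 m).prod (𝓡 3)) 𝓘(ℝ, Fin 3 → ℝ) ∞
      (fun q a => etaHat ι a q (A q)) p := contMDiffAt_pi_space.2 h2
  -- Inversion is smooth at invertible operators, so the coordinates of `A` are recovered smoothly
  -- from its components.
  have h5 : ContMDiffAt ((𝓡 m).prod (𝓡 3)) 𝓘(ℝ, EuclideanSpace ℝ (Fin m) × (Fin 3 → ℝ) →L[ℝ]
      EuclideanSpace ℝ (Fin m) × EuclideanSpace ℝ (Fin 3)) ∞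
      (fun q => (frameMapTriv ι p q).inverse) p :=
    ((isInvertible_frameMapTriv ι hp hp').contDiffAt_map_inverse (n := ∞)).contMDiffAt.comp p
      (contMDiffAt_frameMapTriv ι p)
  have h6 := h5.clm_apply (h3.prodMk_space h4)
  refine (e.contMDiffAt_section_iff hp).2 (h6.congr_of_eventuallyEq ?_)
  filter_upwards [e.open_baseSet.mem_nhds hp,
    (contMDiff_proj ι).continuous.continuousAt.eventually (e'.open_baseSet.mem_nhds hp')] with q hq hq'
  have h7 : (e ⟨q, A q⟩).2 = e.continuousLinearMapAt ℝ q (A q) := by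
    rw [Trivialization.continuousLinearMapAt_apply, Trivialization.coe_linearMapAt_of_mem _ hq]
  have h8 : frameMapTriv ι p q (e.continuousLinearMapAt ℝ q (A q)) =
      (e'.continuousLinearMapAt ℝ (proj ι q) (dproj ι q (A q)), fun a => etaHat ι a q (A q)) := by
    have h9 := e.symmL_continuousLinearMapAt (R := ℝ) hq (A q)
    refine Prod.ext ?_ ?_
    · change e'.continuousLinearMapAt ℝ (proj ι q) (dproj ι q
        (e.symmL ℝ q (e.continuousLinearMapAt ℝ q (A q)))) = _
      rw [h9]
    · funext a
      change etaHat ι a q (e.symmL ℝ q (e.continuousLinearMapAt ℝ q (A q))) = _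
      rw [h9]
  rw [h7, ← h8]
  exact ((isInvertible_frameMapTriv ι hq hq').inverse_apply_self _).symm

theorem isSmoothField_vert (a : Fin 3) : IsSmoothField ((𝓡 m).prod (𝓡 3)) (vert ι a) := by
  intro p
  refine isSmoothFieldAt_of_dproj_etaHat ι ?_ fun b => ?_
  · have : (fun q => (⟨proj ι q, dproj ι q (vert ι a q)⟩ : TangentBundle (𝓡 m) B)) =
        fun q => ⟨proj ι q, 0⟩ := by
      funext q
      rw [dproj_vert]
    rw [this]
    exact (contMDiff_zeroSection ℝ (TangentSpace (𝓡 m) (M := B)) (n := ∞)).contMDiffAt.comp p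
      (contMDiff_proj ι p)
  · simp only [etaHat_vert]
    exact contMDiffAt_const

theorem isSmoothField_liftField {X : ∀ b : B, TangentSpace (𝓡 m) b} (hX : IsSmoothField (𝓡 m) X) :
    IsSmoothField ((𝓡 m).prod (𝓡 3)) (liftField ι X) := by
  intro p
  refine isSmoothFieldAt_of_dproj_etaHat ι ?_ fun b => ?_
  · simp only [dproj_liftField]
    exact (hX (proj ι p)).comp p (contMDiff_proj ι p)
  · simp only [liftField, etaHat_hlift]
    exact contMDiffAt_const

/-! ### Lie brackets of vertical fields and horizontal lifts. -/

/-- The connection form on brackets of vector fields with constant vertical components. -/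
theorem connForm_mlieBracket {A A' : ∀ p : InducedBundle ι, TangentSpace ((𝓡 m).prod (𝓡 3)) p}
    (hA : IsSmoothField ((𝓡 m).prod (𝓡 3)) A) (hA' : IsSmoothField ((𝓡 m).prod (𝓡 3)) A')
    {c c' : ℍ} (hc : ∀ p, connForm ι p (A p) = c) (hc' : ∀ p, connForm ι p (A' p) = c')
    (p : InducedBundle ι) :
    connForm ι p (mlieBracket ((𝓡 m).prod (𝓡 3)) A A' p) =
      herm n (dvec ι p (A p)) (dvec ι p (A' p)) - herm n (dvec ι p (A' p)) (dvec ι p (A p)) := by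
  -- Differentiate the constant `⟨dh A', h⟩ = c'` along `A` by the product rule. Combined with `d²h
  -- = 0`, the second derivatives of `h` are thereby replaced by first derivatives.
  have key : ∀ (A A' : ∀ p : InducedBundle ι, TangentSpace ((𝓡 m).prod (𝓡 3)) p),
      IsSmoothField ((𝓡 m).prod (𝓡 3)) A' → ∀ {c' : ℍ}, (∀ p, connForm ι p (A' p) = c') →
      herm n (mvfderiv ((𝓡 m).prod (𝓡 3)) (fun q => dvec ι q (A' q)) p (A p)) (toVec ι p) =
        -herm n (dvec ι p (A' p)) (dvec ι p (A p)) := by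
    intro A A' hA' c' hc'
    have h1 := mvfderiv_bilinear (herm n) (f := fun q => dvec ι q (A' q)) (x := p)
      ((contMDiffAt_mvfderiv_apply (contMDiff_toVec ι p) (hA' p)).mdifferentiableAt (by simp))
      (mdifferentiableAt_toVec ι p) (A p)
    have h2 : (fun q => herm n (dvec ι q (A' q)) (toVec ι q)) = fun _ => c' := by
      funext q
      rw [← connForm_apply, hc']
    rw [h2, mvfderiv_const] at h1
    exact eq_neg_of_add_eq_zero_left h1.symm
  rw [connForm_apply, dvec, mvfderiv_mlieBracket (contMDiff_toVec ι p) (hA p) (hA' p)]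
  have h3 : ∀ u v w : HVec n, herm n (u - v) w = herm n u w - herm n v w := fun u v w => by
    rw [herm_apply, herm_apply, herm_apply, ← Finset.sum_sub_distrib]
    exact Finset.sum_congr rfl fun j _ => sub_mul _ _ _
  refine (h3 _ _ _).trans ((congrArg₂ _ (key A A' hA' hc') (key A' A hA hc)).trans ?_)
  rw [sub_neg_eq_add, neg_add_eq_sub]
  rfl

theorem connForm_mlieBracket_vert (a b : Fin 3) (p : InducedBundle ι) :
    connForm ι p (mlieBracket ((𝓡 m).prod (𝓡 3)) (vert ι a) (vert ι b) p) =
      imagUnit b * imagUnit a - imagUnit a * imagUnit b := by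
  have hs : ∀ a, star (imagUnit a) = -imagUnit a := fun a => by
    ext <;> simp [re_imagUnit]
  rw [connForm_mlieBracket ι (isSmoothField_vert ι a) (isSmoothField_vert ι b)
    (connForm_vert ι a) (connForm_vert ι b), dvec_vert, dvec_vert]
  simp only [herm_neg_left, herm_neg_right, herm_smul_left, herm_smul_right, herm_toVec_self, hs,
    mul_one, mul_neg, neg_mul, neg_neg]
  abel

/-- Since `dh(ξₐ)` is a left quaternionic multiple of `h`, its pairings with `dh(X*)` are multiples
of `⟨h, dh X*⟩` and `⟨dh X*, h⟩`, which vanish because `X*` is horizontal. -/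
theorem connForm_mlieBracket_vert_liftField (a : Fin 3) {X : ∀ b : B, TangentSpace (𝓡 m) b}
    (hX : IsSmoothField (𝓡 m) X) (p : InducedBundle ι) :
    connForm ι p (mlieBracket ((𝓡 m).prod (𝓡 3)) (vert ι a) (liftField ι X) p) = 0 := by
  have h1 : herm n (dvec ι p (liftField ι X p)) (toVec ι p) = 0 := by
    rw [← connForm_apply, liftField, connForm_hlift]
  have h2 : herm n (toVec ι p) (dvec ι p (liftField ι X p)) = 0 := by
    rw [← star_herm, h1, star_zero]
  rw [connForm_mlieBracket ι (isSmoothField_vert ι a) (isSmoothField_liftField ι hX)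
    (connForm_vert ι a) (fun q => connForm_hlift ι q _), dvec_vert]
  simp only [herm_neg_left, herm_neg_right, herm_smul_left, herm_smul_right, h1, h2]
  simp

theorem etaHat_eq_zero_of_connForm {p : InducedBundle ι}
    {v : TangentSpace ((𝓡 m).prod (𝓡 3)) p} (h : connForm ι p v = 0) (a : Fin 3) :
    etaHat ι a p v = 0 := by
  rw [etaHat_apply, h, inner_zero_right, neg_zero]

theorem dproj_mlieBracket_vert_vert (a b : Fin 3) (p : InducedBundle ι) :
    dproj ι p (mlieBracket ((𝓡 m).prod (𝓡 3)) (vert ι a) (vert ι b) p) = 0 := by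
  have h0 : IsSmoothField (𝓡 m) (0 : ∀ b : B, TangentSpace (𝓡 m) b) :=
    contMDiff_zeroSection ℝ (TangentSpace (𝓡 m) (M := B))
  have h := mfderiv_mlieBracket_of_related (contMDiff_proj ι) (x := p)
    (isSmoothField_vert ι a p) (isSmoothField_vert ι b p) (h0 _) (h0 _)
    (dproj_vert ι a) (dproj_vert ι b)
  rw [mlieBracket_zero_left] at h
  exact h

theorem dproj_mlieBracket_vert_liftField (a : Fin 3) {X : ∀ b : B, TangentSpace (𝓡 m) b}
    (hX : IsSmoothField (𝓡 m) X) (p : InducedBundle ι) :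
    dproj ι p (mlieBracket ((𝓡 m).prod (𝓡 3)) (vert ι a) (liftField ι X) p) = 0 := by
  have h0 : IsSmoothField (𝓡 m) (0 : ∀ b : B, TangentSpace (𝓡 m) b) :=
    contMDiff_zeroSection ℝ (TangentSpace (𝓡 m) (M := B))
  have h := mfderiv_mlieBracket_of_related (contMDiff_proj ι) (x := p)
    (isSmoothField_vert ι a p) (isSmoothField_liftField ι hX p) (h0 _) (hX _)
    (dproj_vert ι a) (dproj_liftField ι X)
  rw [mlieBracket_zero_left] at h
  exact h

theorem dproj_mlieBracket_liftField {X Y : ∀ b : B, TangentSpace (𝓡 m) b}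
    (hX : IsSmoothField (𝓡 m) X) (hY : IsSmoothField (𝓡 m) Y) (p : InducedBundle ι) :
    dproj ι p (mlieBracket ((𝓡 m).prod (𝓡 3)) (liftField ι X) (liftField ι Y) p) =
      mlieBracket (𝓡 m) X Y (proj ι p) :=
  mfderiv_mlieBracket_of_related (contMDiff_proj ι) (isSmoothField_liftField ι hX p)
    (isSmoothField_liftField ι hY p) (hX _) (hY _) (dproj_liftField ι X) (dproj_liftField ι Y)

/-- This expresses the invariance of the connection under `S³`, obtained here from components: the
bracket projects to `[0, X] = 0`, and `ω` vanishes on it. -/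
theorem mlieBracket_vert_liftField (a : Fin 3) {X : ∀ b : B, TangentSpace (𝓡 m) b}
    (hX : IsSmoothField (𝓡 m) X) (p : InducedBundle ι) :
    mlieBracket ((𝓡 m).prod (𝓡 3)) (vert ι a) (liftField ι X) p = 0 := by
  refine tangent_ext ι ?_ fun b => ?_
  · rw [dproj_mlieBracket_vert_liftField ι a hX, map_zero]
  · rw [etaHat_eq_zero_of_connForm ι (connForm_mlieBracket_vert_liftField ι a hX p), map_zero]

/-- Here `ω([ξ₁, ξ₃]) = ki - ik = 2j`, and `ω(ξ₂) = -j`. -/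
theorem mlieBracket_vert_zero_two (p : InducedBundle ι) :
    mlieBracket ((𝓡 m).prod (𝓡 3)) (vert ι 0) (vert ι 2) p = (-2 : ℝ) • vert ι 1 p := by
  refine tangent_ext ι ?_ fun b => ?_
  · rw [dproj_mlieBracket_vert_vert, map_smul, dproj_vert, smul_zero]
  · rw [etaHat_apply, connForm_mlieBracket_vert, map_smul, etaHat_vert]
    fin_cases b <;> simp [quaternion_inner_eq, re_imagUnit, imI_imagUnit, imJ_imagUnit,
      imK_imagUnit]
    norm_num

theorem mlieBracket_vert_one_two (p : InducedBundle ι) :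
    mlieBracket ((𝓡 m).prod (𝓡 3)) (vert ι 1) (vert ι 2) p = (2 : ℝ) • vert ι 0 p := by
  refine tangent_ext ι ?_ fun b => ?_
  · rw [dproj_mlieBracket_vert_vert, map_smul, dproj_vert, smul_zero]
  · rw [etaHat_apply, connForm_mlieBracket_vert, map_smul, etaHat_vert]
    fin_cases b <;> simp [quaternion_inner_eq, re_imagUnit, imI_imagUnit, imJ_imagUnit,
      imK_imagUnit]
    norm_num

/-- `ω` vanishes on lifts, so only the bracket term of `dω` survives. Curvature hypotheses thus
become statements about vertical parts of brackets. -/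
theorem curvature_liftField (X Y : ∀ b : B, TangentSpace (𝓡 m) b) (p : InducedBundle ι) :
    curvature ι (liftField ι X) (liftField ι Y) p =
      -connForm ι p (mlieBracket ((𝓡 m).prod (𝓡 3)) (liftField ι X) (liftField ι Y) p) := by
  have h : ∀ X : ∀ b : B, TangentSpace (𝓡 m) b,
      (fun q => connForm ι q (liftField ι X q)) = fun _ => 0 :=
    fun X => funext fun q => connForm_hlift ι q _
  rw [curvature, horPart_liftField, horPart_liftField, formDeriv, h, h, mvfderiv_const]
  simp

/-! ### The almost complex structure. -/

variable (S : SasakianStructure m B)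

theorem acs_apply (p : InducedBundle ι) (v : TangentSpace ((𝓡 m).prod (𝓡 3)) p) :
    acs ι S p v = etaHat ι 0 p v • vert ι 1 p - etaHat ι 1 p v • vert ι 0 p +
      etaHat ι 2 p v • liftField ι S.ξ p - S.η (proj ι p) (dproj ι p v) • vert ι 2 p +
      hlift ι p (S.φ (proj ι p) (dproj ι p v)) := rfl

theorem dproj_acs (p : InducedBundle ι) (v : TangentSpace ((𝓡 m).prod (𝓡 3)) p) :
    dproj ι p (acs ι S p v) = etaHat ι 2 p v • S.ξ (proj ι p) +
      S.φ (proj ι p) (dproj ι p v) := by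
  simp only [acs_apply, map_add, map_sub, map_smul, dproj_vert, dproj_hlift, dproj_liftField,
    smul_zero, sub_zero, zero_add]

theorem etaHat_acs (a : Fin 3) (p : InducedBundle ι) (v : TangentSpace ((𝓡 m).prod (𝓡 3)) p) :
    etaHat ι a p (acs ι S p v) =
      ![-etaHat ι 1 p v, etaHat ι 0 p v, -S.η (proj ι p) (dproj ι p v)] a := by
  simp only [acs_apply, map_add, map_sub, map_smul, etaHat_vert, etaHat_hlift, liftField]
  fin_cases a <;> simp

theorem acs_acs (p : InducedBundle ι) (v : TangentSpace ((𝓡 m).prod (𝓡 3)) p) :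
    acs ι S p (acs ι S p v) = -v := by
  refine tangent_ext ι ?_ fun a => ?_
  · rw [dproj_acs, etaHat_acs, dproj_acs, map_add, map_smul, S.φ_ξ, S.φ_sq, map_neg]
    simp
  · rw [etaHat_acs, etaHat_acs, etaHat_acs, dproj_acs, map_add, map_smul, S.η_φ, S.η_ξ, map_neg]
    fin_cases a <;> simp

theorem acs_vert_zero (p : InducedBundle ι) : acs ι S p (vert ι 0 p) = vert ι 1 p := by
  simp [acs_apply, etaHat_vert, dproj_vert]

theorem acs_vert_two (p : InducedBundle ι) : acs ι S p (vert ι 2 p) = liftField ι S.ξ p := by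
  simp [acs_apply, etaHat_vert, dproj_vert]

theorem acs_liftField {X : ∀ b : B, TangentSpace (𝓡 m) b} (hX : ∀ b, S.η b (X b) = 0)
    (p : InducedBundle ι) : acs ι S p (liftField ι X p) = liftField ι (S.φField X) p := by
  rw [acs_apply, dproj_liftField, hX]
  simp only [liftField, etaHat_hlift, SasakianStructure.φField]
  simp

theorem isSmoothEndo_acs : IsSmoothEndo ((𝓡 m).prod (𝓡 3)) (acs ι S) := by
  refine isSmoothEndo_of_apply fun p A hA => ?_
  have hη := contMDiffAt_etaHat ι hA
  have hd := contMDiffAt_dproj ι hA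
  have h1 : IsSmoothFieldAt ((𝓡 m).prod (𝓡 3)) (fun q => etaHat ι 0 q (A q) • vert ι 1 q) p :=
    (hη 0).smul_section (isSmoothField_vert ι 1 p)
  have h2 : IsSmoothFieldAt ((𝓡 m).prod (𝓡 3)) (fun q => etaHat ι 1 q (A q) • vert ι 0 q) p :=
    (hη 1).smul_section (isSmoothField_vert ι 0 p)
  have h3 : IsSmoothFieldAt ((𝓡 m).prod (𝓡 3))
      (fun q => etaHat ι 2 q (A q) • liftField ι S.ξ q) p :=
    (hη 2).smul_section (isSmoothField_liftField ι S.smooth_ξ p)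
  have h4 : IsSmoothFieldAt ((𝓡 m).prod (𝓡 3))
      (fun q => S.η (proj ι q) (dproj ι q (A q)) • vert ι 2 q) p :=
    (S.smooth_η.apply_comp (contMDiff_proj ι p) hd).smul_section (isSmoothField_vert ι 2 p)
  have h5 : IsSmoothFieldAt ((𝓡 m).prod (𝓡 3))
      (fun q => hlift ι q (S.φ (proj ι q) (dproj ι q (A q)))) p := by
    refine isSmoothFieldAt_of_dproj_etaHat ι ?_ fun a => ?_
    · simp only [dproj_hlift]
      exact S.smooth_φ.apply_comp (contMDiff_proj ι p) hd
    · simp only [etaHat_hlift]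
      exact contMDiffAt_const
  exact (((h1.sub_section h2).add_section h3).sub_section h4).add_section h5

/-- A complex antilinear map vanishes if it vanishes on `ξ₁`, `ξ₃` and the lifts of the fields
orthogonal to `ξ`. -/
theorem eq_zero_of_antilinear [T2Space B] {p : InducedBundle ι}
    (L : TangentSpace ((𝓡 m).prod (𝓡 3)) p →L[ℝ] TangentSpace ((𝓡 m).prod (𝓡 3)) p)
    (hL : ∀ v, L (acs ι S p v) = -acs ι S p (L v))
    (h0 : L (vert ι 0 p) = 0) (h2 : L (vert ι 2 p) = 0)
    (hX : ∀ X : ∀ b : B, TangentSpace (𝓡 m) b, IsSmoothField (𝓡 m) X → (∀ b, S.η b (X b) = 0) →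
      L (liftField ι X p) = 0) (v : TangentSpace ((𝓡 m).prod (𝓡 3)) p) : L v = 0 := by
  have h1 : L (vert ι 1 p) = 0 := by
    rw [← acs_vert_zero ι S, hL, h0, map_zero, neg_zero]
  have h3 : L (liftField ι S.ξ p) = 0 := by
    rw [← acs_vert_two ι S, hL, h2, map_zero, neg_zero]
  -- `hX` concerns fields orthogonal to `ξ` on all of `B`, so `dπ v` is extended globally and its
  -- `ξ`-component is then removed.
  obtain ⟨X, hXs, hXp⟩ := exists_isSmoothField_eq (I := 𝓡 m) (proj ι p) (dproj ι p v)
  let Y : ∀ b : B, TangentSpace (𝓡 m) b := fun b => X b - S.η b (X b) • S.ξ b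
  have hYs : IsSmoothField (𝓡 m) Y := fun b =>
    (hXs b).sub_section ((S.smooth_η.apply (hXs.smoothAt b)).smul_section (S.smooth_ξ b))
  have hY : ∀ b, S.η b (Y b) = 0 := fun b => by
    simp only [Y, map_sub, map_smul, S.η_ξ, smul_eq_mul, mul_one, sub_self]
  have hv : v = etaHat ι 0 p v • vert ι 0 p + etaHat ι 1 p v • vert ι 1 p +
      etaHat ι 2 p v • vert ι 2 p + S.η (proj ι p) (dproj ι p v) • liftField ι S.ξ p +
      liftField ι Y p := by
    refine tangent_ext ι ?_ fun a => ?_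
    · simp only [map_add, map_smul, dproj_vert, dproj_liftField, Y, hXp]
      simp
    · simp only [map_add, map_smul, etaHat_vert, liftField, etaHat_hlift]
      fin_cases a <;> simp
  rw [hv]
  simp only [map_add, map_smul, h0, h1, h2, h3, hX Y hYs hY, smul_zero, add_zero]

/-! ### The Nijenhuis tensor on generators. -/

theorem nijenhuis_vert_zero_vert_two (p : InducedBundle ι) :
    nijenhuis ((𝓡 m).prod (𝓡 3)) (acs ι S) (vert ι 0) (vert ι 2) p = 0 := by
  have h0 : (fun q => acs ι S q (vert ι 0 q)) = vert ι 1 := funext (acs_vert_zero ι S)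
  have h2 : (fun q => acs ι S q (vert ι 2 q)) = liftField ι S.ξ := funext (acs_vert_two ι S)
  -- What remains is `-[ξ₁, ξ₃] - J[ξ₂, ξ₃] = 2ξ₂ - 2Jξ₁ = 0`.
  rw [nijenhuis, h0, h2, acs_acs, mlieBracket_vert_zero_two, mlieBracket_vert_one_two,
    mlieBracket_vert_liftField ι _ S.smooth_ξ, mlieBracket_vert_liftField ι _ S.smooth_ξ,
    map_zero, map_smul, acs_vert_zero]
  module

/-- `Jξ₁ = ξ₂` is again vertical and `JX*` is again a lift, so each bracket is of a vertical field
with a lift. -/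
theorem nijenhuis_vert_zero_liftField {X : ∀ b : B, TangentSpace (𝓡 m) b}
    (hXs : IsSmoothField (𝓡 m) X) (hX : ∀ b, S.η b (X b) = 0) (p : InducedBundle ι) :
    nijenhuis ((𝓡 m).prod (𝓡 3)) (acs ι S) (vert ι 0) (liftField ι X) p = 0 := by
  have h0 : (fun q => acs ι S q (vert ι 0 q)) = vert ι 1 := funext (acs_vert_zero ι S)
  have h2 : (fun q => acs ι S q (liftField ι X q)) = liftField ι (S.φField X) :=
    funext (acs_liftField ι S hX)
  have hφ := S.isSmoothField_φField hXs
  rw [nijenhuis, h0, h2, mlieBracket_vert_liftField ι _ hXs, mlieBracket_vert_liftField ι _ hXs,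
    mlieBracket_vert_liftField ι _ hφ, mlieBracket_vert_liftField ι _ hφ]
  simp only [map_zero, add_zero, sub_zero]

theorem nijenhuis_vert_two_liftField {X : ∀ b : B, TangentSpace (𝓡 m) b}
    (hξ : ∀ X : ∀ b : B, TangentSpace (𝓡 m) b, IsSmoothField (𝓡 m) X → (∀ b, S.η b (X b) = 0) →
      ∀ p, connForm ι p (mlieBracket ((𝓡 m).prod (𝓡 3)) (liftField ι S.ξ) (liftField ι X) p) = 0)
    (hXs : IsSmoothField (𝓡 m) X) (hX : ∀ b, S.η b (X b) = 0) (p : InducedBundle ι) :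
    nijenhuis ((𝓡 m).prod (𝓡 3)) (acs ι S) (vert ι 2) (liftField ι X) p = 0 := by
  have h0 : (fun q => acs ι S q (vert ι 2 q)) = liftField ι S.ξ := funext (acs_vert_two ι S)
  have h2 : (fun q => acs ι S q (liftField ι X q)) = liftField ι (S.φField X) :=
    funext (acs_liftField ι S hX)
  have hφ := S.isSmoothField_φField hXs
  have hXξ := etaHat_eq_zero_of_connForm ι (hξ X hXs hX p)
  have hφξ := etaHat_eq_zero_of_connForm ι (hξ _ hφ (fun b => S.η_φ b _) p)
  -- By `hξ` both brackets are horizontal, and `η([ξ, X]) = 0`, so `J` acts through `φ`; the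
  -- identity is then `[ξ, φX] = φ[ξ, X]` on `B`.
  have h3 : mlieBracket ((𝓡 m).prod (𝓡 3)) (liftField ι S.ξ) (liftField ι (S.φField X)) p =
      acs ι S p (mlieBracket ((𝓡 m).prod (𝓡 3)) (liftField ι S.ξ) (liftField ι X) p) := by
    refine tangent_ext ι ?_ fun a => ?_
    · rw [dproj_acs, dproj_mlieBracket_liftField ι S.smooth_ξ hφ,
        dproj_mlieBracket_liftField ι S.smooth_ξ hXs, hXξ, zero_smul, zero_add,
        S.mlieBracket_ξ_φ hXs hX]
    · rw [etaHat_acs, dproj_mlieBracket_liftField ι S.smooth_ξ hXs, S.η_mlieBracket_ξ hXs hX, hXξ,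
        hXξ, hφξ]
      fin_cases a <;> simp
  rw [nijenhuis, h0, h2, mlieBracket_vert_liftField ι _ hXs, mlieBracket_vert_liftField ι _ hφ, h3]
  simp only [map_zero, zero_add, sub_self]

theorem nijenhuis_liftField_liftField {X Y : ∀ b : B, TangentSpace (𝓡 m) b}
    (hΩ : ∀ X Y : ∀ b : B, TangentSpace (𝓡 m) b, IsSmoothField (𝓡 m) X → IsSmoothField (𝓡 m) Y →
      (∀ b, S.η b (X b) = 0) → (∀ b, S.η b (Y b) = 0) → ∀ p,
      connForm ι p (mlieBracket ((𝓡 m).prod (𝓡 3)) (liftField ι (S.φField X))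
        (liftField ι (S.φField Y)) p) =
      connForm ι p (mlieBracket ((𝓡 m).prod (𝓡 3)) (liftField ι X) (liftField ι Y) p))
    (hXs : IsSmoothField (𝓡 m) X) (hYs : IsSmoothField (𝓡 m) Y)
    (hX : ∀ b, S.η b (X b) = 0) (hY : ∀ b, S.η b (Y b) = 0) (p : InducedBundle ι) :
    nijenhuis ((𝓡 m).prod (𝓡 3)) (acs ι S) (liftField ι X) (liftField ι Y) p = 0 := by
  have hφX := S.isSmoothField_φField hXs
  have hφY := S.isSmoothField_φField hYs
  have h0 : (fun q => acs ι S q (liftField ι X q)) = liftField ι (S.φField X) :=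
    funext (acs_liftField ι S hX)
  have h2 : (fun q => acs ι S q (liftField ι Y q)) = liftField ι (S.φField Y) :=
    funext (acs_liftField ι S hY)
  have h3 : liftField ι (S.φField (S.φField X)) = (-1 : ℝ) • liftField ι X := by
    funext q
    change hlift ι q (S.φ _ (S.φ _ (X _))) = (-1 : ℝ) • hlift ι q (X _)
    rw [S.φ_φ_of_η_eq_zero (hX _), map_neg, neg_one_smul]
  have hω : ∀ a, etaHat ι a p (mlieBracket ((𝓡 m).prod (𝓡 3)) (liftField ι (S.φField X))
        (liftField ι (S.φField Y)) p) =
      etaHat ι a p (mlieBracket ((𝓡 m).prod (𝓡 3)) (liftField ι X) (liftField ι Y) p) := fun a => by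
    rw [etaHat_apply, etaHat_apply, hΩ X Y hXs hYs hX hY]
  -- The invariance of `Ω` applied to `φX` and `Y`, with `φ²X = -X`, gives `Ω(X*, (φY)*) = -Ω((φX)*,
  -- Y*)`.
  have hω' : ∀ a, etaHat ι a p (mlieBracket ((𝓡 m).prod (𝓡 3)) (liftField ι X)
        (liftField ι (S.φField Y)) p) =
      -etaHat ι a p (mlieBracket ((𝓡 m).prod (𝓡 3)) (liftField ι (S.φField X))
        (liftField ι Y) p) := fun a => by
    have h4 := hΩ (S.φField X) Y hφX hYs (fun b => S.η_φ b _) hY p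
    rw [h3, mlieBracket_const_smul_left ((isSmoothField_liftField ι hXs).smoothAt p).mdifferentiableAt,
      map_smul, neg_one_smul] at h4
    rw [etaHat_apply, etaHat_apply, ← h4, inner_neg_right, neg_neg]
  have hη := S.η_mlieBracket_φ_add hXs hYs hX hY (proj ι p)
  have hN := S.normal_of_η_eq_zero hXs hYs hX hY (proj ι p)
  rw [nijenhuis, h0, h2, acs_acs]
  refine tangent_ext ι ?_ fun a => ?_
  -- `J` sends the `ξ₃`-parts of the two mixed brackets to multiples of `ξ*`; these cancel by `hω'`,
  -- and normality on `B` remains.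
  · rw [map_zero, ← hN]
    simp only [map_add, map_sub, map_neg, dproj_acs, dproj_mlieBracket_liftField ι hXs hYs,
      dproj_mlieBracket_liftField ι hφX hφY, dproj_mlieBracket_liftField ι hφX hYs,
      dproj_mlieBracket_liftField ι hXs hφY, hω']
    module
  · rw [map_zero]
    simp only [map_add, map_sub, map_neg, etaHat_acs, dproj_mlieBracket_liftField ι hφX hYs,
      dproj_mlieBracket_liftField ι hXs hφY, hω, hω']
    fin_cases a <;> simp
    -- The `ξ₃`-component: the mixed brackets contribute `η([φX, Y]) + η([X, φY])`, which is zero by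
    -- `hη`.
    linarith

end InducedBundle

end HopfSasaki

end

/-! ### Integrability from the vanishing on generators. -/

open HopfSasaki
theorem mainTheorem2 (n m : ℕ) {B : Type*} [TopologicalSpace B]
    [ChartedSpace (EuclideanSpace ℝ (Fin m)) B] [IsManifold (𝓡 m) ∞ B] [T2Space B] [CompactSpace B]
    (ι : C^∞⟮𝓡 m, B; 𝓘(ℝ, Fin n → ℍ), HP n⟯)
    (hι : Manifold.IsImmersion (𝓡 m) 𝓘(ℝ, Fin n → ℍ) ∞ ι)
    (S : SasakianStructure m B)
    (hΩ : ∀ X Y : ∀ b : B, TangentSpace (𝓡 m) b,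
      IsSmoothField (𝓡 m) X → IsSmoothField (𝓡 m) Y →
      (∀ b, S.metric.inner b (X b) (S.ξ b) = 0) → (∀ b, S.metric.inner b (Y b) (S.ξ b) = 0) →
      ∀ p : InducedBundle ι,
        InducedBundle.curvature ι (InducedBundle.liftField ι fun b => S.φ b (X b))
          (InducedBundle.liftField ι fun b => S.φ b (Y b)) p =
        InducedBundle.curvature ι (InducedBundle.liftField ι X) (InducedBundle.liftField ι Y) p)
    (hξ : ∀ X : ∀ b : B, TangentSpace (𝓡 m) b, IsSmoothField (𝓡 m) X →
      (∀ b, S.metric.inner b (X b) (S.ξ b) = 0) →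
      ∀ p : InducedBundle ι,
        InducedBundle.curvature ι (InducedBundle.liftField ι X) (InducedBundle.liftField ι S.ξ) p = 0) :
    IsIntegrableAlmostComplex ((𝓡 m).prod (𝓡 3)) (InducedBundle.acs ι S) := by
  have hΩ' : ∀ X Y : ∀ b : B, TangentSpace (𝓡 m) b,
      IsSmoothField (𝓡 m) X → IsSmoothField (𝓡 m) Y →
      (∀ b, S.η b (X b) = 0) → (∀ b, S.η b (Y b) = 0) → ∀ p : InducedBundle ι,
      InducedBundle.connForm ι p (mlieBracket ((𝓡 m).prod (𝓡 3))
        (InducedBundle.liftField ι (S.φField X)) (InducedBundle.liftField ι (S.φField Y)) p) =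
      InducedBundle.connForm ι p (mlieBracket ((𝓡 m).prod (𝓡 3))
        (InducedBundle.liftField ι X) (InducedBundle.liftField ι Y) p) := by
    intro X Y hXs hYs hX hY p
    have h := hΩ X Y hXs hYs (fun b => (S.inner_ξ b _).trans (hX b))
      (fun b => (S.inner_ξ b _).trans (hY b)) p
    rw [InducedBundle.curvature_liftField, InducedBundle.curvature_liftField] at h
    exact neg_injective h
  have hξ' : ∀ X : ∀ b : B, TangentSpace (𝓡 m) b, IsSmoothField (𝓡 m) X →
      (∀ b, S.η b (X b) = 0) → ∀ p : InducedBundle ι,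
      InducedBundle.connForm ι p (mlieBracket ((𝓡 m).prod (𝓡 3))
        (InducedBundle.liftField ι S.ξ) (InducedBundle.liftField ι X) p) = 0 := by
    intro X hXs hX p
    have h := hξ X hXs (fun b => (S.inner_ξ b _).trans (hX b)) p
    rw [InducedBundle.curvature_liftField, mlieBracket_swap_apply, map_neg, neg_neg] at h
    exact h
  have hJ := InducedBundle.isSmoothEndo_acs ι S
  have hsq := InducedBundle.acs_acs ι S
  have hr := fun (p : InducedBundle ι) v w => nijenhuisAt_apply_right hJ hsq (x := p) v w
  refine ⟨hJ, hsq, fun X Y hX hY p => ?_⟩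
  rw [← nijenhuisAt_apply hJ (hX p) (hY p)]
  have hv := InducedBundle.isSmoothField_vert ι
  have hs := fun (X : ∀ b : B, TangentSpace (𝓡 m) b) (hX : IsSmoothField (𝓡 m) X) =>
    InducedBundle.isSmoothField_liftField ι hX
  have h02 : nijenhuisAt hJ p (InducedBundle.vert ι 0 p) (InducedBundle.vert ι 2 p) = 0 := by
    rw [nijenhuisAt_apply hJ (hv 0 p) (hv 2 p), InducedBundle.nijenhuis_vert_zero_vert_two]
  have h0X : ∀ X : ∀ b : B, TangentSpace (𝓡 m) b, IsSmoothField (𝓡 m) X →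
      (∀ b, S.η b (X b) = 0) →
      nijenhuisAt hJ p (InducedBundle.vert ι 0 p) (InducedBundle.liftField ι X p) = 0 := by
    intro X hXs hX
    rw [nijenhuisAt_apply hJ (hv 0 p) (hs X hXs p),
      InducedBundle.nijenhuis_vert_zero_liftField ι S hXs hX]
  have h2X : ∀ X : ∀ b : B, TangentSpace (𝓡 m) b, IsSmoothField (𝓡 m) X →
      (∀ b, S.η b (X b) = 0) →
      nijenhuisAt hJ p (InducedBundle.vert ι 2 p) (InducedBundle.liftField ι X p) = 0 := by
    intro X hXs hX
    rw [nijenhuisAt_apply hJ (hv 2 p) (hs X hXs p),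
      InducedBundle.nijenhuis_vert_two_liftField ι S hξ' hXs hX]
  -- Skewness carries vanishing from the first slot to the second. Antilinearity can therefore be
  -- used in the second slot for `ξ₁`, `ξ₃`, the lifts and finally an arbitrary first argument, each
  -- case supplying generator values for the later ones.
  have hfix : ∀ v, (∀ w, nijenhuisAt hJ p v w = 0) → ∀ w, nijenhuisAt hJ p w v = 0 := by
    intro v h w
    rw [nijenhuisAt_swap, h, neg_zero]
  have h0 : ∀ w, nijenhuisAt hJ p (InducedBundle.vert ι 0 p) w = 0 :=
    InducedBundle.eq_zero_of_antilinear ι S _ (hr p _) (nijenhuisAt_self hJ _) h02 h0X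
  have h2 : ∀ w, nijenhuisAt hJ p (InducedBundle.vert ι 2 p) w = 0 :=
    InducedBundle.eq_zero_of_antilinear ι S _ (hr p _) (hfix _ h0 _) (nijenhuisAt_self hJ _) h2X
  have hXY : ∀ X : ∀ b : B, TangentSpace (𝓡 m) b, IsSmoothField (𝓡 m) X →
      (∀ b, S.η b (X b) = 0) → ∀ w, nijenhuisAt hJ p (InducedBundle.liftField ι X p) w = 0 := by
    intro X hXs hX
    refine InducedBundle.eq_zero_of_antilinear ι S _ (hr p _) (hfix _ h0 _) (hfix _ h2 _) ?_
    intro Y hYs hY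
    rw [nijenhuisAt_apply hJ (hs X hXs p) (hs Y hYs p),
      InducedBundle.nijenhuis_liftField_liftField ι S hΩ' hXs hYs hX hY]
  exact InducedBundle.eq_zero_of_antilinear ι S (nijenhuisAt hJ p (X p)) (hr p _) (hfix _ h0 _)
    (hfix _ h2 _) (fun Z hZs hZ => hfix _ (hXY Z hZs hZ) _) (Y p)
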